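/- Let $X$ be a continuum (a nonempty compact connected Hausdorff space; $X$ need not be metrizable) and let $2^X$ be the lattice of closed subsets of $X$ under $\cup,\cap$. For a compact Hausdorff space $Y$ let $C(Y)$ be the hyperspace of nonempty subcontinua of $Y$ with the Vietoris topology. For a distributive lattice $N$ with $0$ and $1$ let $wN$ be its Wallman space: the set of ultrafilters (maximal proper filters) on $N$, with the sets $\widehat a=\{u\in wN : a\in u\}$, $a\in N$, as a base for the closed sets. Let $\kappa$ be a regular cardinal with $\mathcal P(\mathcal P(X))\in H(\kappa)$, where $H(\kappa)$ is the set of all sets whose transitive closure has cardinality less than $\kappa$, and let $\mathcal M\prec H(\kappa)$ be a countable elementary submodel (in the language $\{\in\}$) such that the topological space $X$ is an element of $\mathcal M$. Put $L=2^X\cap\mathcal M$. For a finite family $\mathcal F\subseteq 2^X$ put $$\mathcal F^*=C(X)\setminus\Bigl\{G\in C(X) : G\cap\bigcap\mathcal F=\emptyset \text{ and } F\cup G\neq F \text{ for all } F\in\mathcal F\Bigr\},$$ let $K^*$ be the sublattice of $(\mathcal P(C(X)),\cup,\cap,\emptyset,C(X))$ generated by the sets $\mathcal F^*$ for all finite $\mathcal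 F\subseteq 2^X$, and put $K=K^*\cap\mathcal M$. Then $wK^*$ is homeomorphic to $C(X)$; $L$ is a sublattice of $2^X$ containing $\emptyset$ and $X$, and $K$ is a sublattice of $K^*$ containing $\emptyset$ and $C(X)$; the space $wL$ is a metrizable continuum; and $wK$ is homeomorphic to $C(wL)$. -/

import Mathlib

open TopologicalSpace Cardinal

universe u

noncomputable section

namespace HyperspaceReflection

/-! ### Set theory: transitive closures, `H(κ)`, the membership structure -/

/-- The transitive closure `TC(x) = x ∪ ⋃ x ∪ ⋃ ⋃ x ∪ …` of a set. -/
def transClosure (x : ZFSet.{u}) : Set ZFSet.{u} :=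
  {y | ∃ n : ℕ, y ∈ ZFSet.sUnion^[n] x}

/-- `H(κ)`: the sets whose transitive closure has fewer than `κ` elements. -/
def HSet (κ : Cardinal.{u}) : Set ZFSet.{u} :=
  {x | #(transClosure x) < Cardinal.lift.{u + 1} κ}

/-- The single relation symbol of the language of set theory. -/
inductive MemRel : ℕ → Type
  | mem : MemRel 2

/-- The first-order language `{∈}` of set theory. -/
def setLang : FirstOrder.Language.{0, 0} := ⟨fun _ => Empty, MemRel⟩

/-- `H(κ)` with the true membership relation. -/
instance instStructureHSet (κ : Cardinal.{u}) : setLang.Structure (HSet κ) where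
  funMap := fun f => Empty.elim f
  RelMap := fun r =>
    match r with
    | MemRel.mem => fun v => (v 0 : ZFSet.{u}) ∈ (v 1 : ZFSet.{u})

/-- The set of ZFC sets that belong to the elementary submodel `M ≺ H(κ)`. -/
def elems {κ : Cardinal.{u}} (M : setLang.ElementarySubstructure (HSet κ)) : Set ZFSet.{u} :=
  Subtype.val '' (M : Set (HSet κ))

/-- If every `a : α` is realised by the ZFC set `e a`, then `s : Set α` is realised by the
ZFC set `{e a | a ∈ s}`. -/
def code {α : Type u} (e : α → ZFSet.{u}) (s : Set α) : ZFSet.{u} :=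
  ZFSet.range (fun a : s => e a)

/-! ### Wallman spaces -/

/-- The Wallman space `wL` of a lattice: the set of ultrafilters, i.e. maximal proper filters,
of `L`. (In a lattice with least element `0`, a filter is proper iff it does not contain `0`.) -/
def Wallman (L : Type*) [DistribLattice L] : Type _ :=
  {p : Order.PFilter L // Maximal (fun q : Order.PFilter L => (q : Set L) ≠ Set.univ) p}

/-- The basic closed set `â` of all ultrafilters containing `a`. -/
def hat {L : Type*} [DistribLattice L] (a : L) : Set (Wallman L) := {p | a ∈ p.1}

/-- The topology on `wL` whose closed sets have the sets `â` as a base. -/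
instance instTopologicalSpaceWallman (L : Type*) [DistribLattice L] :
    TopologicalSpace (Wallman L) :=
  TopologicalSpace.generateFrom {U | ∃ a : L, U = (hat a)ᶜ}

/-! ### The hyperspace of subcontinua -/

/-- `C(X)`: the nonempty compact connected subsets of `X`, with the subspace topology of the
Vietoris topology on the nonempty compact subsets. -/
abbrev Subcontinua (X : Type*) [TopologicalSpace X] : Type _ :=
  {G : NonemptyCompacts X // IsConnected (G : Set X)}

section Lattices

variable {X : Type u} [TopologicalSpace X]

/-- The ZFC set realising a subcontinuum `G` of `X`, when the points of `X` are realised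
through `e`. -/
def codeSubcontinuum (e : X → ZFSet.{u}) (G : Subcontinua X) : ZFSet.{u} :=
  code e (G.1 : Set X)

/-- The ZFC set `(X, τ)` realising the topological space `X`. -/
def codeSpace (X : Type u) [TopologicalSpace X] (e : X → ZFSet.{u}) : ZFSet.{u} :=
  ZFSet.pair (code e Set.univ) (code (code e) {U : Set X | IsOpen U})

/-- The set `𝓕* = C(X) \ {G | G ∩ ⋂ 𝓕 = ∅ ∧ ∀ F ∈ 𝓕, F ∪ G ≠ F}`. -/
def starSet (𝓕 : Set (Closeds X)) : Set (Subcontinua X) :=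
  {G | (G.1 : Set X) ∩ (⋂ F ∈ 𝓕, (F : Set X)) = ∅ ∧
    ∀ F ∈ 𝓕, (F : Set X) ∪ (G.1 : Set X) ≠ (F : Set X)}ᶜ

variable (X) in
/-- The lattice `K*`: the sublattice of `(𝒫(C(X)), ∪, ∩, ∅, C(X))` generated by the sets `𝓕*`
with `𝓕` a finite family of closed subsets of `X`. -/
def latticeKStar : Sublattice (Set (Subcontinua X)) :=
  sInf {S : Sublattice (Set (Subcontinua X)) |
    ({∅, Set.univ} : Set (Set (Subcontinua X))) ∪
      {A | ∃ 𝓕 : Set (Closeds X), 𝓕.Finite ∧ A = starSet 𝓕} ⊆ (S : Set (Set (Subcontinua X)))}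

end Lattices

end HyperspaceReflection

end

open HyperspaceReflection

/-!
The proof combines three ingredients.

*Wallman representation.* If a bounded distributive lattice is mapped by a lattice homomorphism,
killing only `⊥`, to closed subsets of a compact space whose values separate points in the sense
of Hausdorff, then its Wallman space is that compact space (`Wallman.nonempty_homeomorph`). The
complements of the sets `𝓕*` are Vietoris basic open sets, so this applies at once to `K*` and
`C(X)`. If the lattice is normal and disjunctive, then its Wallman space is Hausdorff, disjoint
closed sets are separated by disjoint elements of the lattice (`Wallman.exists_subset_hat`), and
connected elements of the lattice yield connected closed sets (`Wallman.isPreconnected_hat`). By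
elementarity `L` is normal and disjunctive, and it is countable; hence `wL` is a metrizable
continuum.

*Elementarity.* Definability in `H(κ)` is handled semantically: `Dfn M ρ P` says that `P` is
expressed by a formula in the coordinates `ρ` and parameters from `M`, and definability is
preserved by quantification over points, closed sets and subcontinua of `X`. Since an element of
`K*` is the value of a lattice term at closed sets, elementarity shows that `K` is generated by
the sets `𝓕*` with `𝓕` a finite family from `L` (`latticeKStar_induction`).

*Transfer.* It remains to represent `K` by closed subsets of `C(wL)`. For a subcontinuum `H` of
`wL` let the tests of `H` (`IsTest`) be the families `{G ∈ C(X) | G ⊆ a, G meets every c j}` with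
`a` and finitely many `c j` in `L` such that `H ⊆ â` and `H` meets every `ĉ j`. The set
corresponding to `A ∈ K` consists of those `H` with a test contained in `A`; otherwise `H` has a
test disjoint from `A` (`isDual_starSet` and induction). That this is well defined and a
homomorphism depends on tests being nonempty (`IsTest.nonempty`): if no subcontinuum of `a` meets
every `c j`, then, components being intersections of clopen sets, `a` is covered by finitely many
relatively clopen sets `P j` such that `P j` misses `c j`; by elementarity there are such sets in
`L`, and then the connected set `H ⊆ â`, which meets every `ĉ j`, would have to miss all the sets
given by the `P j`, although these cover it. Finally, a nonempty `A ∈ K` has a member `G` that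
belongs to `M`, and `Ĝ` is a subcontinuum of `wL` in the set corresponding to `A`
(`IsDual.nonempty`).
-/

/-! ### Definability in `H(κ)` with parameters from an elementary submodel -/

namespace HyperspaceReflection

section Definability

variable {κ : Cardinal.{u}} {M : setLang.ElementarySubstructure (HSet κ)} {α : Type}
  {Γ ι : Type*} {ρ : α → Γ → HSet κ}

variable (M) in
/-- Let the elements of a type `Γ` be interpreted in `H(κ)` by the coordinates `ρ`. A property of
elements of `Γ` is definable over `M` if it is expressed by a first-order formula of set theory
whose free variables are either coordinates or parameters from `M`. -/
def Dfn (ρ : α → Γ → HSet κ) (P : Γ → Prop) : Prop :=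
  ∃ φ : setLang.Formula (α ⊕ M), ∀ γ, φ.Realize (Sum.elim (ρ · γ) Subtype.val) ↔ P γ

variable (M) in
/-- A function into `H(κ)` which is a coordinate, or constant with value in `M`. -/
def IsVar (ρ : α → Γ → HSet κ) (f : Γ → HSet κ) : Prop :=
  ∃ s : α ⊕ M, ∀ γ, f γ = Sum.elim (ρ · γ) Subtype.val s

/-- The coordinates of `Γ × ι` that extend the coordinates `ρ` of `Γ` by `c`. -/
def extendCoord (ρ : α → Γ → HSet κ) (c : ι → HSet κ) : α ⊕ Unit → Γ × ι → HSet κ :=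
  Sum.elim (fun a p => ρ a p.1) (fun _ p => c p.2)

variable (M) in
/-- The range of `c : ι → H(κ)` is definable over `M`. -/
def DfnRange (c : ι → HSet κ) : Prop := Dfn M (fun (_ : Unit) (y : HSet κ) => y) (∃ i, c i = ·)

namespace Dfn

variable {P Q : Γ → Prop}

theorem congr (h : Dfn M ρ P) (hPQ : ∀ γ, P γ ↔ Q γ) : Dfn M ρ Q := by
  obtain ⟨φ, hφ⟩ := h
  exact ⟨φ, fun γ => (hφ γ).trans (hPQ γ)⟩

theorem mem {f g : Γ → HSet κ} (hf : IsVar M ρ f) (hg : IsVar M ρ g) :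
    Dfn M ρ fun γ => (f γ).1 ∈ (g γ).1 := by
  obtain ⟨s, hs⟩ := hf
  obtain ⟨t, ht⟩ := hg
  let R : setLang.Relations 2 := MemRel.mem
  refine ⟨R.formula₂ (FirstOrder.Language.Term.var s) (FirstOrder.Language.Term.var t),
    fun γ => ?_⟩
  beta_reduce
  rw [FirstOrder.Language.Formula.realize_rel₂, hs, ht]
  exact Iff.rfl

theorem eq {f g : Γ → HSet κ} (hf : IsVar M ρ f) (hg : IsVar M ρ g) :
    Dfn M ρ fun γ => f γ = g γ := by
  obtain ⟨s, hs⟩ := hf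
  obtain ⟨t, ht⟩ := hg
  refine ⟨(FirstOrder.Language.Term.var s).equal (FirstOrder.Language.Term.var t), fun γ => ?_⟩
  beta_reduce
  rw [FirstOrder.Language.Formula.realize_equal, hs, ht]
  exact Iff.rfl

theorem not (h : Dfn M ρ P) : Dfn M ρ fun γ => ¬ P γ := by
  obtain ⟨φ, hφ⟩ := h
  exact ⟨φ.not, fun γ => by rw [FirstOrder.Language.Formula.realize_not, hφ]⟩

theorem and (h : Dfn M ρ P) (h' : Dfn M ρ Q) : Dfn M ρ fun γ => P γ ∧ Q γ := by
  obtain ⟨φ, hφ⟩ := h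
  obtain ⟨ψ, hψ⟩ := h'
  exact ⟨φ ⊓ ψ, fun γ => by rw [FirstOrder.Language.Formula.realize_inf, hφ, hψ]⟩

theorem or (h : Dfn M ρ P) (h' : Dfn M ρ Q) : Dfn M ρ fun γ => P γ ∨ Q γ :=
  (h.not.and h'.not).not.congr fun γ => by tauto

theorem imp (h : Dfn M ρ P) (h' : Dfn M ρ Q) : Dfn M ρ fun γ => P γ → Q γ :=
  (h.not.or h').congr fun γ => by tauto

theorem iff (h : Dfn M ρ P) (h' : Dfn M ρ Q) : Dfn M ρ fun γ => (P γ ↔ Q γ) :=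
  ((h.imp h').and (h'.imp h)).congr fun γ => by tauto

theorem all_fin {J : Type} [Finite J] {P : Γ → J → Prop} (h : ∀ j, Dfn M ρ fun γ => P γ j) :
    Dfn M ρ fun γ => ∀ j, P γ j := by
  choose φ hφ using h
  exact ⟨FirstOrder.Language.Formula.iInf φ, fun γ => by
    simp only [FirstOrder.Language.Formula.realize_iInf, hφ]⟩

theorem ex_fin {J : Type} [Finite J] {P : Γ → J → Prop} (h : ∀ j, Dfn M ρ fun γ => P γ j) :
    Dfn M ρ fun γ => ∃ j, P γ j :=
  (all_fin fun j => (h j).not).not.congr fun γ => by push Not; rfl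

theorem reindex {Δ : Type*} {β : Type} {σ : β → Δ → HSet κ} (h : Dfn M ρ P) (f : Δ → Γ)
    (r : α → β) (hr : ∀ a δ, σ (r a) δ = ρ a (f δ)) : Dfn M σ fun δ => P (f δ) := by
  obtain ⟨φ, hφ⟩ := h
  refine ⟨φ.relabel (Sum.map r id), fun δ => ?_⟩
  have key : Sum.elim (σ · δ) Subtype.val ∘ Sum.map r (id : M → M) =
      Sum.elim (ρ · (f δ)) Subtype.val := by
    ext1 (a | m)
    · exact hr a δ
    · rfl
  rw [FirstOrder.Language.Formula.realize_relabel, key, hφ]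

/-- Definability is preserved by quantification over a definable class, parametrized by `c`. -/
theorem ex {c : ι → HSet κ} (hc : DfnRange M c) {P : Γ → ι → Prop}
    (h : Dfn M (extendCoord ρ c) fun p => P p.1 p.2) : Dfn M ρ fun γ => ∃ i, P γ i := by
  obtain ⟨φ, hφ⟩ := h
  obtain ⟨ψ, hψ⟩ := hc
  let r : (α ⊕ Unit) ⊕ M → (α ⊕ M) ⊕ Unit :=
    Sum.elim (Sum.elim (fun a => .inl (.inl a)) .inr) (fun m => .inl (.inr m))
  let r' : Unit ⊕ M → (α ⊕ M) ⊕ Unit := Sum.elim .inr (fun m => .inl (.inr m))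
  refine ⟨(φ.relabel r ⊓ ψ.relabel r').iExs Unit, fun γ => ?_⟩
  have key : ∀ i, (Sum.elim (Sum.elim (ρ · γ) Subtype.val) (fun _ : Unit => c i)) ∘ r =
      Sum.elim (extendCoord ρ c · (γ, i)) Subtype.val := by
    intro i
    ext1 ((a | b) | m) <;> rfl
  have key' : ∀ x : Unit → HSet κ, (Sum.elim (Sum.elim (ρ · γ) Subtype.val) x) ∘ r' =
      Sum.elim (fun _ => x ()) Subtype.val := by
    intro i
    ext1 (b | m) <;> rfl
  simp only [FirstOrder.Language.Formula.realize_iExs, FirstOrder.Language.Formula.realize_inf,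
    FirstOrder.Language.Formula.realize_relabel, key', hψ]
  constructor
  · rintro ⟨x, hx, i, hi⟩
    obtain rfl : x = fun _ => c i := funext fun _ => hi.symm
    rw [key, hφ] at hx
    exact ⟨i, hx⟩
  · rintro ⟨i, hi⟩
    refine ⟨fun _ => c i, ?_, i, rfl⟩
    rw [key, hφ]
    exact hi

theorem all {c : ι → HSet κ} (hc : DfnRange M c) {P : Γ → ι → Prop}
    (h : Dfn M (extendCoord ρ c) fun p => P p.1 p.2) : Dfn M ρ fun γ => ∀ i, P γ i :=
  (ex hc (P := fun γ i => ¬ P γ i) h.not).not.congr fun v => by push Not; rfl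

theorem range_id : DfnRange M (id : HSet κ → HSet κ) :=
  (Dfn.eq (f := id) ⟨.inl (), fun _ => rfl⟩ ⟨.inl (), fun _ => rfl⟩).congr fun y =>
    ⟨fun _ => ⟨y, rfl⟩, fun _ => rfl⟩

/-- Elementarity: if a definable property holds for a family of elements of a definable class, then
it holds for such a family consisting of elements of `M`. -/
theorem reflect [Finite α] {c : ι → HSet κ} (hc : DfnRange M c) {P : (α → ι) → Prop}
    (h : Dfn M (fun a v => c (v a)) P) {v : α → ι} (hv : P v) :
    ∃ w : α → ι, (∀ a, c (w a) ∈ M) ∧ P w := by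
  obtain ⟨ψ, hψ⟩ := all_fin (ρ := fun a (v : α → HSet κ) => v a) fun a =>
    hc.reindex (fun v => v a) (fun _ => a) fun _ _ => rfl
  obtain ⟨φ, hφ⟩ := h
  have key : ∀ i : α → HSet κ, Sum.elim (Subtype.val : M → HSet κ) i ∘ Sum.swap =
      Sum.elim i Subtype.val := by
    intro i
    ext1 (a | m) <;> rfl
  have h1 : (((φ ⊓ ψ).relabel Sum.swap).iExs α).Realize (M.subtype ∘ (id : M → M)) := by
    rw [FirstOrder.Language.Formula.realize_iExs]
    refine ⟨fun a => c (v a), ?_⟩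
    rw [FirstOrder.Language.Formula.realize_relabel]
    refine (congrArg (φ ⊓ ψ).Realize (key _)).mpr ?_
    rw [FirstOrder.Language.Formula.realize_inf, hψ]
    exact ⟨(hφ v).2 hv, fun a => ⟨v a, rfl⟩⟩
  rw [M.subtype.map_formula, FirstOrder.Language.Formula.realize_iExs] at h1
  obtain ⟨x, hx⟩ := h1
  rw [FirstOrder.Language.Formula.realize_relabel, ← M.subtype.map_formula] at hx
  have hx' : (φ ⊓ ψ).Realize (Sum.elim (fun a => (x a : HSet κ)) Subtype.val) := by
    convert! hx using 1
    ext1 (a | m) <;> rfl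
  rw [FirstOrder.Language.Formula.realize_inf, hψ] at hx'
  choose w hw using hx'.2
  refine ⟨w, fun a => (hw a).symm ▸ (x a).2, (hφ w).1 ?_⟩
  simp only [hw]
  exact hx'.1

/-- An element of `H(κ)` that is definable over `M` belongs to `M`. -/
theorem mem_of_unique {x : HSet κ} {P : HSet κ → Prop}
    (h : Dfn M (fun (_ : Unit) (y : HSet κ) => y) P) (hx : P x) (hu : ∀ y, P y → y = x) :
    x ∈ M := by
  obtain ⟨w, hw, hP⟩ := reflect (α := Unit) range_id (P := fun v => P (v ()))
    (h.reindex (fun v : Unit → HSet κ => v ()) id fun _ _ => rfl) (v := fun _ => x) hx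
  exact hu _ hP ▸ hw ()

end Dfn

end Definability

end HyperspaceReflection

/-! ### Coding subsets of `X` and of `C(X)` in `H(κ)` -/

namespace HyperspaceReflection

theorem mem_code {α : Type u} {f : α → ZFSet.{u}} {s : Set α} {z : ZFSet.{u}} :
    z ∈ code f s ↔ ∃ a ∈ s, f a = z := by
  simp [code]

theorem code_injective {α : Type u} {f : α → ZFSet.{u}} (hf : f.Injective) :
    (code f).Injective := by
  have key : ∀ (s : Set α) (a : α), f a ∈ code f s ↔ a ∈ s := fun s a => by
    rw [mem_code]
    exact ⟨fun ⟨b, hb, h⟩ => hf h ▸ hb, fun h => ⟨a, h, rfl⟩⟩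
  intro s t h
  ext a
  rw [← key s, ← key t, h]

theorem iterate_sUnion_mono {x y : ZFSet.{u}} (h : x ⊆ y) (n : ℕ) :
    ZFSet.sUnion^[n] x ⊆ ZFSet.sUnion^[n] y := by
  induction n generalizing x y with
  | zero => exact h
  | succ n ih =>
    refine ih ?_
    intro z hz
    obtain ⟨w, hw, hzw⟩ := ZFSet.mem_sUnion.1 hz
    exact ZFSet.mem_sUnion.2 ⟨w, h hw, hzw⟩

theorem mem_HSet_of_subset {κ : Cardinal.{u}} {x y : ZFSet.{u}} (hy : y ∈ HSet κ) (h : x ⊆ y) :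
    x ∈ HSet κ := by
  refine (Cardinal.mk_le_mk_of_subset ?_).trans_lt hy
  rintro _ ⟨n, hn⟩
  exact ⟨n, iterate_sUnion_mono h n hn⟩

theorem mem_HSet_of_mem {κ : Cardinal.{u}} {x y : ZFSet.{u}} (hy : y ∈ HSet κ) (h : x ∈ y) :
    x ∈ HSet κ := by
  have hU : ZFSet.sUnion y ∈ HSet κ := by
    refine (Cardinal.mk_le_mk_of_subset ?_).trans_lt hy
    rintro _ ⟨n, hn⟩
    exact ⟨n + 1, hn⟩
  refine mem_HSet_of_subset hU ?_
  intro z hz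
  exact ZFSet.mem_sUnion.2 ⟨x, h, hz⟩

section Coding

variable {X : Type u} [TopologicalSpace X] {e : X ↪ ZFSet.{u}} {κ : Cardinal.{u}}

omit [TopologicalSpace X] in
theorem code_family_mem_HSet {α : Type u} (f : α → Set X) (s : Set α)
    (hX : (code e Set.univ).powerset.powerset ∈ HSet κ) :
    code (fun a => code e (f a)) s ∈ HSet κ := by
  refine mem_HSet_of_mem hX (ZFSet.mem_powerset.2 ?_)
  intro z hz
  obtain ⟨a, -, rfl⟩ := mem_code.1 hz
  refine ZFSet.mem_powerset.2 ?_
  intro w hw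
  obtain ⟨b, -, rfl⟩ := mem_code.1 hw
  exact mem_code.2 ⟨b, trivial, rfl⟩

omit [TopologicalSpace X] in
theorem code_mem_HSet (hX : (code e Set.univ).powerset.powerset ∈ HSet κ) (s : Set X) :
    code e s ∈ HSet κ := by
  have hP : (code e Set.univ).powerset ∈ HSet κ :=
    mem_HSet_of_mem hX (ZFSet.mem_powerset.2 subset_rfl)
  refine mem_HSet_of_mem hP (ZFSet.mem_powerset.2 ?_)
  intro w hw
  obtain ⟨b, -, rfl⟩ := mem_code.1 hw
  exact mem_code.2 ⟨b, trivial, rfl⟩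

/-- The element of `H(κ)` that realises a point of `X`. -/
noncomputable def ptH (hX : (code e Set.univ).powerset.powerset ∈ HSet κ) (a : X) : HSet κ :=
  ⟨e a, mem_HSet_of_mem (code_mem_HSet hX Set.univ) (mem_code.2 ⟨a, trivial, rfl⟩)⟩

/-- The element of `H(κ)` that realises a subset of `X`. -/
noncomputable def setH (hX : (code e Set.univ).powerset.powerset ∈ HSet κ) (s : Set X) : HSet κ :=
  ⟨code e s, code_mem_HSet hX s⟩

/-- The element of `H(κ)` that realises a set of subcontinua of `X`. -/
noncomputable def famH (hX : (code e Set.univ).powerset.powerset ∈ HSet κ) (A : Set (Subcontinua X)) : HSet κ :=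
  ⟨code (codeSubcontinuum e) A, code_family_mem_HSet _ A hX⟩

/-- The element of `H(κ)` that realises the topology of `X`. -/
noncomputable def topH (hX : (code e Set.univ).powerset.powerset ∈ HSet κ) : HSet κ :=
  ⟨code (code e) {U : Set X | IsOpen U}, code_family_mem_HSet id _ hX⟩

variable {hX : (code e Set.univ).powerset.powerset ∈ HSet κ}

omit [TopologicalSpace X] in
@[simp]
theorem ptH_mem_setH {a : X} {s : Set X} : (ptH hX a).1 ∈ (setH hX s).1 ↔ a ∈ s :=
  mem_code.trans ⟨fun ⟨_, hb, h⟩ => e.injective h ▸ hb, fun h => ⟨a, h, rfl⟩⟩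

omit [TopologicalSpace X] in
theorem setH_injective : (setH hX).Injective := fun _ _ h =>
  code_injective e.injective (congrArg Subtype.val h)

theorem codeSubcontinuum_injective : (codeSubcontinuum (X := X) e).Injective := fun _ _ h =>
  Subtype.ext (SetLike.coe_injective (code_injective e.injective h))

@[simp]
theorem setH_mem_famH {G : Subcontinua X} {A : Set (Subcontinua X)} :
    (setH hX (G.1 : Set X)).1 ∈ (famH hX A).1 ↔ G ∈ A :=
  mem_code.trans ⟨fun ⟨_, hb, h⟩ => codeSubcontinuum_injective h ▸ hb, fun h => ⟨G, h, rfl⟩⟩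

omit [TopologicalSpace X] in
theorem eq_ptH_of_mem {z : HSet κ} {s : Set X} (h : z.1 ∈ (setH hX s).1) : ∃ a, ptH hX a = z := by
  obtain ⟨a, -, h⟩ := mem_code.1 h
  exact ⟨a, Subtype.ext h⟩

theorem eq_setH_of_mem {z : HSet κ} {A : Set (Subcontinua X)} (h : z.1 ∈ (famH hX A).1) :
    ∃ G ∈ A, setH hX (G.1 : Set X) = z := by
  obtain ⟨G, hG, h⟩ := mem_code.1 h
  exact ⟨G, hG, Subtype.ext h⟩

theorem HSet_ext {x y : HSet κ} (h : ∀ z : HSet κ, z.1 ∈ x.1 ↔ z.1 ∈ y.1) : x = y := by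
  refine Subtype.ext (ZFSet.ext fun z => ⟨fun hz => ?_, fun hz => ?_⟩)
  · exact (h ⟨z, mem_HSet_of_mem x.2 hz⟩).1 hz
  · exact (h ⟨z, mem_HSet_of_mem y.2 hz⟩).2 hz

/-- Subsets of the set of points are recognised among the elements of `H(κ)`. -/
theorem exists_setH_eq {y : HSet κ} (h : ∀ z : HSet κ, z.1 ∈ y.1 → z.1 ∈ (setH hX Set.univ).1) :
    setH hX {a | (ptH hX a).1 ∈ y.1} = y := by
  refine HSet_ext fun z => ⟨fun hz => ?_, fun hz => ?_⟩
  · obtain ⟨a, rfl⟩ := eq_ptH_of_mem hz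
    exact ptH_mem_setH (hX := hX) (s := {a | (ptH hX a).1 ∈ y.1}) |>.1 hz
  · obtain ⟨a, rfl⟩ := eq_ptH_of_mem (h z hz)
    exact ptH_mem_setH.2 hz

theorem mem_topH {u : HSet κ} :
    u.1 ∈ (topH (X := X) hX).1 ↔ ∃ U : Set X, IsOpen U ∧ setH hX U = u :=
  mem_code.trans ⟨fun ⟨U, hU, h⟩ => ⟨U, hU, Subtype.ext h⟩,
    fun ⟨U, hU, h⟩ => ⟨U, hU, congrArg Subtype.val h⟩⟩

end Coding

/-! ### Quantifiers over points, closed sets and subcontinua -/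

section Quantifiers

variable {X : Type u} [TopologicalSpace X] {e : X ↪ ZFSet.{u}} {κ : Cardinal.{u}}
  {hX : (code e Set.univ).powerset.powerset ∈ HSet κ}
  {M : setLang.ElementarySubstructure (HSet κ)} {α : Type} {Γ : Type*} {ρ : α → Γ → HSet κ}

namespace Dfn

/-- Definability of membership. The default arguments look for `f` and `g` among the coordinates and
the parameters from `M` that are known to the context. -/
theorem memH {f g : Γ → HSet κ}
    (hf : IsVar M ρ f := by
      first
      | exact ⟨.inl (.inr ()), fun _ => rfl⟩
      | exact ⟨.inl (.inl (.inr ())), fun _ => rfl⟩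
      | exact ⟨.inl (.inl (.inl (.inr ()))), fun _ => rfl⟩
      | exact ⟨.inl (), fun _ => rfl⟩
      | exact ⟨.inl (.inl ()), fun _ => rfl⟩
      | exact ⟨.inl (.inl (.inl ())), fun _ => rfl⟩
      | exact ⟨.inl _, fun _ => rfl⟩
      | exact ⟨.inl (.inl _), fun _ => rfl⟩
      | exact ⟨.inl (.inl (.inl _)), fun _ => rfl⟩
      | exact ⟨.inl (.inl (.inl (.inl _))), fun _ => rfl⟩
      | exact ⟨.inr ⟨_, by assumption⟩, fun _ => rfl⟩)
    (hg : IsVar M ρ g := by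
      first
      | exact ⟨.inl (.inr ()), fun _ => rfl⟩
      | exact ⟨.inl (.inl (.inr ())), fun _ => rfl⟩
      | exact ⟨.inl (.inl (.inl (.inr ()))), fun _ => rfl⟩
      | exact ⟨.inl (), fun _ => rfl⟩
      | exact ⟨.inl (.inl ()), fun _ => rfl⟩
      | exact ⟨.inl (.inl (.inl ())), fun _ => rfl⟩
      | exact ⟨.inl _, fun _ => rfl⟩
      | exact ⟨.inl (.inl _), fun _ => rfl⟩
      | exact ⟨.inl (.inl (.inl _)), fun _ => rfl⟩
      | exact ⟨.inl (.inl (.inl (.inl _))), fun _ => rfl⟩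
      | exact ⟨.inr ⟨_, by assumption⟩, fun _ => rfl⟩) :
    Dfn M ρ fun γ => (f γ).1 ∈ (g γ).1 :=
  mem hf hg

/-- Definability of equality, with the same default arguments as `memH`. -/
theorem eqH {f g : Γ → HSet κ}
    (hf : IsVar M ρ f := by
      first
      | exact ⟨.inl (.inr ()), fun _ => rfl⟩
      | exact ⟨.inl (.inl (.inr ())), fun _ => rfl⟩
      | exact ⟨.inl (.inl (.inl (.inr ()))), fun _ => rfl⟩
      | exact ⟨.inl (), fun _ => rfl⟩
      | exact ⟨.inl (.inl ()), fun _ => rfl⟩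
      | exact ⟨.inl (.inl (.inl ())), fun _ => rfl⟩
      | exact ⟨.inl _, fun _ => rfl⟩
      | exact ⟨.inl (.inl _), fun _ => rfl⟩
      | exact ⟨.inl (.inl (.inl _)), fun _ => rfl⟩
      | exact ⟨.inl (.inl (.inl (.inl _))), fun _ => rfl⟩
      | exact ⟨.inr ⟨_, by assumption⟩, fun _ => rfl⟩)
    (hg : IsVar M ρ g := by
      first
      | exact ⟨.inl (.inr ()), fun _ => rfl⟩
      | exact ⟨.inl (.inl (.inr ())), fun _ => rfl⟩
      | exact ⟨.inl (.inl (.inl (.inr ()))), fun _ => rfl⟩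
      | exact ⟨.inl (), fun _ => rfl⟩
      | exact ⟨.inl (.inl ()), fun _ => rfl⟩
      | exact ⟨.inl (.inl (.inl ())), fun _ => rfl⟩
      | exact ⟨.inl _, fun _ => rfl⟩
      | exact ⟨.inl (.inl _), fun _ => rfl⟩
      | exact ⟨.inl (.inl (.inl _)), fun _ => rfl⟩
      | exact ⟨.inl (.inl (.inl (.inl _))), fun _ => rfl⟩
      | exact ⟨.inr ⟨_, by assumption⟩, fun _ => rfl⟩) :
    Dfn M ρ fun γ => f γ = g γ :=
  eq hf hg

variable (hX) in
/-- Definability of the membership of points in subsets of `X`, with default arguments as in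
`memH`. -/
theorem ptMem {f : Γ → X} {g : Γ → Set X}
    (hf : IsVar M ρ (fun γ => ptH hX (f γ)) := by
      first
      | exact ⟨.inl (.inr ()), fun _ => rfl⟩
      | exact ⟨.inl (.inl (.inr ())), fun _ => rfl⟩
      | exact ⟨.inl (.inl (.inl (.inr ()))), fun _ => rfl⟩
      | exact ⟨.inl (), fun _ => rfl⟩
      | exact ⟨.inl _, fun _ => rfl⟩
      | exact ⟨.inl (.inl _), fun _ => rfl⟩
      | exact ⟨.inl (.inl (.inl _)), fun _ => rfl⟩)
    (hg : IsVar M ρ (fun γ => setH hX (g γ)) := by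
      first
      | exact ⟨.inl (.inr ()), fun _ => rfl⟩
      | exact ⟨.inl (.inl (.inr ())), fun _ => rfl⟩
      | exact ⟨.inl (.inl (.inl (.inr ()))), fun _ => rfl⟩
      | exact ⟨.inl (.inl (.inl (.inl (.inr ())))), fun _ => rfl⟩
      | exact ⟨.inl (), fun _ => rfl⟩
      | exact ⟨.inl (.inl ()), fun _ => rfl⟩
      | exact ⟨.inl (.inl (.inl ())), fun _ => rfl⟩
      | exact ⟨.inl _, fun _ => rfl⟩
      | exact ⟨.inl (.inl _), fun _ => rfl⟩
      | exact ⟨.inl (.inl (.inl _)), fun _ => rfl⟩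
      | exact ⟨.inl (.inl (.inl (.inl _))), fun _ => rfl⟩
      | exact ⟨.inr ⟨_, by assumption⟩, fun _ => rfl⟩) :
    Dfn M ρ fun γ => f γ ∈ g γ :=
  (mem hf hg).congr fun _ => ptH_mem_setH

theorem range_ptH (hP : setH hX Set.univ ∈ M) : DfnRange M (ptH hX) :=
  (memH (f := id) (g := fun _ => setH hX Set.univ)).congr fun y =>
    ⟨eq_ptH_of_mem, fun h => h.choose_spec ▸ ptH_mem_setH.2 trivial⟩

theorem range_setH_closeds (hP : setH hX Set.univ ∈ M) (hT : topH (X := X) hX ∈ M) :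
    DfnRange M fun F : Closeds X => setH hX (F : Set X) := by
  have h : Dfn M (fun (_ : Unit) (y : HSet κ) => y) fun y =>
      (∀ z : HSet κ, z.1 ∈ y.1 → z.1 ∈ (setH hX Set.univ).1) ∧
        ∃ u : HSet κ, u.1 ∈ (topH (X := X) hX).1 ∧
          ∀ a : X, (ptH hX a).1 ∈ u.1 ↔ ¬ (ptH hX a).1 ∈ y.1 :=
    (all range_id ((memH).imp memH)).and
      (ex range_id ((memH).and (all (range_ptH hP) ((memH).iff (memH).not))))
  refine h.congr fun y => ⟨?_, ?_⟩
  · rintro ⟨h1, u, hu, h2⟩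
    obtain ⟨U, hU, rfl⟩ := mem_topH.1 hu
    refine ⟨⟨Uᶜ, hU.isClosed_compl⟩, ?_⟩
    rw [← exists_setH_eq h1]
    refine congrArg (setH hX) (Set.ext fun a => ?_)
    have := h2 a
    simp only [ptH_mem_setH] at this
    simp [this]
  · rintro ⟨F, rfl⟩
    refine ⟨fun z hz => ?_, setH hX (F : Set X)ᶜ, mem_topH.2 ⟨_, F.isClosed.isOpen_compl, rfl⟩,
      fun a => by simp⟩
    obtain ⟨a, rfl⟩ := eq_ptH_of_mem hz
    simp

/-- Being a subcontinuum is definable, because connectedness of a closed set only involves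
quantification over closed sets. -/
theorem range_setH_subcontinua [CompactSpace X] [T2Space X] (hP : setH hX Set.univ ∈ M)
    (hT : topH (X := X) hX ∈ M) :
    DfnRange M fun G : Subcontinua X => setH hX (G.1 : Set X) := by
  have hpt := range_ptH hP
  have hcl := range_setH_closeds hP hT
  have h : Dfn M (fun (_ : Unit) (y : HSet κ) => y) fun y =>
      ∃ F : Closeds X, setH hX (F : Set X) = y ∧ (∃ a, a ∈ (F : Set X)) ∧
        ∀ P Q : Closeds X, (∀ a, a ∈ (F : Set X) → a ∈ (P : Set X) ∨ a ∈ (Q : Set X)) →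
          (∀ a, a ∈ (F : Set X) → ¬ (a ∈ (P : Set X) ∧ a ∈ (Q : Set X))) →
          (∀ a, a ∈ (F : Set X) → a ∈ (P : Set X)) ∨
            ∀ a, a ∈ (F : Set X) → a ∈ (Q : Set X) := by
    refine ex hcl ((eqH).and
      (.and ?_ (all hcl (all hcl (.imp ?_ (.imp ?_ (.or ?_ ?_)))))))
    · exact ex hpt (ptMem hX)
    · exact all hpt ((ptMem hX).imp ((ptMem hX).or (ptMem hX)))
    · exact all hpt ((ptMem hX).imp ((ptMem hX).and (ptMem hX)).not)
    · exact all hpt ((ptMem hX).imp (ptMem hX))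
    · exact all hpt ((ptMem hX).imp (ptMem hX))
  refine h.congr fun y => ⟨?_, ?_⟩
  · rintro ⟨F, rfl, ⟨a, ha⟩, hc⟩
    refine ⟨⟨⟨⟨F, F.isClosed.isCompact⟩, ⟨a, ha⟩⟩, ⟨a, ha⟩, ?_⟩, rfl⟩
    refine (isPreconnected_iff_subset_of_fully_disjoint_closed F.isClosed).2 ?_
    intro u v hu hv huv hd
    exact hc ⟨u, hu⟩ ⟨v, hv⟩ (fun a ha => huv ha)
      fun a _ h => Set.disjoint_left.1 hd h.1 h.2
  · rintro ⟨G, rfl⟩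
    refine ⟨⟨G.1, G.1.isCompact.isClosed⟩, rfl, G.2.1, fun P Q hPQ hd => ?_⟩
    refine isPreconnected_iff_subset_of_disjoint_closed.1 G.2.2 P Q P.isClosed Q.isClosed hPQ ?_
    exact Set.eq_empty_of_forall_notMem fun a ha => hd a ha.1 ha.2

/-- A set of points that is definable over `M` belongs to `M`. -/
theorem setH_mem (hP : setH hX Set.univ ∈ M) {s : Set X}
    (h : Dfn M (fun (_ : Unit) (a : X) => ptH hX a) (· ∈ s)) : setH hX s ∈ M := by
  refine mem_of_unique (P := fun y => ∃ z : HSet κ, z = y ∧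
    (∀ w : HSet κ, w.1 ∈ z.1 → w.1 ∈ (setH hX Set.univ).1) ∧ ∀ a : X, (ptH hX a).1 ∈ z.1 ↔ a ∈ s)
    (ex range_id ((eqH).and
      ((all range_id ((memH).imp memH)).and (all (range_ptH hP) ((memH).iff
        (h.reindex Prod.snd .inr fun _ _ => rfl)))))) ?_ ?_
  · refine ⟨_, rfl, fun w hw => ?_, fun a => ptH_mem_setH⟩
    obtain ⟨a, rfl⟩ := eq_ptH_of_mem hw
    simp
  · rintro _ ⟨y, rfl, h1, h2⟩
    rw [← exists_setH_eq h1]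
    simp only [h2]
    rfl

/-- A set of subcontinua that is definable over `M` belongs to `M`. -/
theorem famH_mem [CompactSpace X] [T2Space X] (hP : setH hX Set.univ ∈ M)
    (hT : topH (X := X) hX ∈ M) {A : Set (Subcontinua X)}
    (h : Dfn M (fun (_ : Unit) (G : Subcontinua X) => setH hX (G.1 : Set X)) (· ∈ A)) :
    famH hX A ∈ M := by
  have hsc := range_setH_subcontinua hP hT
  refine mem_of_unique (P := fun y =>
    (∀ w : HSet κ, w.1 ∈ y.1 → ∃ G : Subcontinua X, setH hX (G.1 : Set X) = w) ∧
      ∀ G : Subcontinua X, (setH hX (G.1 : Set X)).1 ∈ y.1 ↔ G ∈ A)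
    ((all range_id ((memH).imp (ex hsc
      eqH))).and
      (all hsc ((memH).iff (h.reindex Prod.snd .inr fun _ _ => rfl)))) ?_ ?_
  · refine ⟨fun w hw => ?_, fun G => setH_mem_famH⟩
    obtain ⟨G, -, rfl⟩ := eq_setH_of_mem hw
    exact ⟨G, rfl⟩
  · rintro y ⟨h1, h2⟩
    refine HSet_ext fun w => ⟨fun hw => ?_, fun hw => ?_⟩
    · obtain ⟨G, rfl⟩ := h1 w hw
      exact setH_mem_famH.2 ((h2 G).1 hw)
    · obtain ⟨G, hG, rfl⟩ := eq_setH_of_mem hw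
      exact (h2 G).2 hG

end Dfn

/-- The set of points and the topology of `X` belong to any elementary submodel that contains the
topological space `X`. -/
theorem setH_univ_mem_and_topH_mem (hXM : codeSpace X e ∈ elems M) :
    setH hX Set.univ ∈ M ∧ topH (X := X) hX ∈ M := by
  obtain ⟨p, hp, hpe⟩ := hXM
  set A := setH hX Set.univ with hA
  set B := topH (X := X) hX with hB
  have hpair : ∀ s : ZFSet.{u}, s ∈ p.1 ↔ s = {A.1} ∨ s = {A.1, B.1} := fun s => by
    rw [hpe]
    exact ZFSet.mem_pair
  have hAM : A ∈ M := by
    refine Dfn.mem_of_unique (P := fun y => ∃ s : HSet κ, s.1 ∈ p.1 ∧ ∀ z : HSet κ,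
      z.1 ∈ s.1 ↔ z = y) (.ex .range_id (.and .memH (.all .range_id (.iff .memH .eqH)))) ?_ ?_
    · have h : {A.1} ∈ p.1 := (hpair _).2 (.inl rfl)
      exact ⟨⟨_, mem_HSet_of_mem p.2 h⟩, h, fun z => ZFSet.mem_singleton.trans Subtype.ext_iff.symm⟩
    · rintro y ⟨s, hs, hy⟩
      refine ((hy A).1 ?_).symm
      rcases (hpair _).1 hs with h | h <;> rw [h] <;> simp
  refine ⟨hAM, Dfn.mem_of_unique (P := fun y => (∃ s : HSet κ, s.1 ∈ p.1 ∧ y.1 ∈ s.1) ∧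
      ∀ s : HSet κ, s.1 ∈ p.1 → ∀ z : HSet κ, z.1 ∈ s.1 → z = A ∨ z = y)
      (.and (.ex .range_id (.and .memH .memH)) (.all .range_id (.imp .memH
        (.all .range_id (.imp .memH (.or .eqH .eqH)))))) ⟨?_, ?_⟩ ?_⟩
  · have h : {A.1, B.1} ∈ p.1 := (hpair _).2 (.inr rfl)
    exact ⟨⟨_, mem_HSet_of_mem p.2 h⟩, h, by simp⟩
  · intro s hs z hz
    rcases (hpair _).1 hs with h | h <;> rw [h] at hz
    · exact .inl (Subtype.ext (ZFSet.mem_singleton.1 hz))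
    · exact (ZFSet.mem_pair.1 hz).imp Subtype.ext Subtype.ext
  · rintro y ⟨⟨s, hs, hys⟩, hy⟩
    have h : {A.1, B.1} ∈ p.1 := (hpair _).2 (.inr rfl)
    rcases hy ⟨_, mem_HSet_of_mem p.2 h⟩ h B (by simp) with hBA | hBy
    · rcases (hpair _).1 hs with h | h <;> rw [h] at hys
      · exact (Subtype.ext (ZFSet.mem_singleton.1 hys)).trans hBA.symm
      · exact (ZFSet.mem_pair.1 hys).elim (fun h => (Subtype.ext h).trans hBA.symm) Subtype.ext
    · exact hBy.symm

end Quantifiers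

end HyperspaceReflection

/-! ### Consequences of elementarity for closed sets and subcontinua -/

namespace HyperspaceReflection

theorem mem_starSet {Y : Type*} [TopologicalSpace Y] {𝓕 : Set (Closeds Y)} {G : Subcontinua Y} :
    G ∈ starSet 𝓕 ↔ (∃ x ∈ (G.1 : Set Y), ∀ F ∈ 𝓕, x ∈ (F : Set Y)) ∨
      ∃ F ∈ 𝓕, (G.1 : Set Y) ⊆ F := by
  simp only [starSet, Set.mem_compl_iff, Set.mem_ofPred_eq, not_and_or, not_forall, not_not,
    Set.union_eq_left, exists_prop, ← Set.nonempty_iff_ne_empty, ← ne_eq]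
  simp [Set.Nonempty]

section Elementarity

variable {X : Type u} [TopologicalSpace X] {e : X ↪ ZFSet.{u}}
  {κ : Cardinal.{u}} {hX : (code e Set.univ).powerset.powerset ∈ HSet κ}
  {M : setLang.ElementarySubstructure (HSet κ)}

theorem setH_union_mem (hP : setH hX Set.univ ∈ M) {s t : Set X} (hs : setH hX s ∈ M)
    (ht : setH hX t ∈ M) : setH hX (s ∪ t) ∈ M :=
  Dfn.setH_mem hP (.or (.ptMem hX) (.ptMem hX))

theorem setH_inter_mem (hP : setH hX Set.univ ∈ M) {s t : Set X} (hs : setH hX s ∈ M)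
    (ht : setH hX t ∈ M) : setH hX (s ∩ t) ∈ M :=
  Dfn.setH_mem hP (.and (.ptMem hX) (.ptMem hX))

theorem setH_empty_mem (hP : setH hX Set.univ ∈ M) : setH hX (∅ : Set X) ∈ M :=
  Dfn.setH_mem hP ((Dfn.ptMem hX (f := id) (g := fun _ => Set.univ)).not.congr fun a => by simp)

theorem Dfn.famMem {α : Type} {Γ : Type*} {ρ : α → Γ → HSet κ} {f : Γ → Subcontinua X}
    {A : Set (Subcontinua X)} (hA : famH hX A ∈ M)
    (hf : IsVar M ρ fun γ => setH hX ((f γ).1 : Set X)) : Dfn M ρ fun γ => f γ ∈ A :=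
  (Dfn.mem hf ⟨.inr ⟨_, hA⟩, fun _ => rfl⟩).congr fun _ => setH_mem_famH

theorem dfn_mem_starSet (hP : setH hX Set.univ ∈ M) {J : Type} [Finite J] :
    Dfn M (extendCoord (fun (j : J) (v : J → Closeds X) => setH hX (v j : Set X))
      (fun G : Subcontinua X => setH hX (G.1 : Set X)))
      fun p => p.2 ∈ starSet (Set.range p.1) := by
  have h : Dfn M (extendCoord (fun (j : J) (v : J → Closeds X) => setH hX (v j : Set X))
      (fun G : Subcontinua X => setH hX (G.1 : Set X)))
      fun p => (∃ x, x ∈ (p.2.1 : Set X) ∧ ∀ j, x ∈ (p.1 j : Set X)) ∨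
        ∃ j, ∀ x, x ∈ (p.2.1 : Set X) → x ∈ (p.1 j : Set X) := by
    refine .or (.ex (Dfn.range_ptH hP) (.and (.ptMem hX) (.all_fin fun j => .ptMem hX)))
      (.ex_fin fun j => .all (Dfn.range_ptH hP) (.imp (.ptMem hX) (.ptMem hX)))
  refine h.congr fun p => ?_
  rw [mem_starSet]
  simp [Set.subset_def]

variable [CompactSpace X] [T2Space X]

section

variable (hP : setH hX Set.univ ∈ M) (hT : topH (X := X) hX ∈ M)

include hP hT

theorem famH_union_mem {A B : Set (Subcontinua X)} (hA : famH hX A ∈ M) (hB : famH hX B ∈ M) :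
    famH hX (A ∪ B) ∈ M :=
  Dfn.famH_mem hP hT ((Dfn.famMem hA ⟨.inl (), fun _ => rfl⟩).or
    (Dfn.famMem hB ⟨.inl (), fun _ => rfl⟩))

theorem famH_inter_mem {A B : Set (Subcontinua X)} (hA : famH hX A ∈ M) (hB : famH hX B ∈ M) :
    famH hX (A ∩ B) ∈ M :=
  Dfn.famH_mem hP hT ((Dfn.famMem hA ⟨.inl (), fun _ => rfl⟩).and
    (Dfn.famMem hB ⟨.inl (), fun _ => rfl⟩))

theorem famH_univ_mem : famH hX (Set.univ : Set (Subcontinua X)) ∈ M :=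
  Dfn.famH_mem hP hT ((Dfn.eqH (f := fun G : Subcontinua X => setH hX (G.1 : Set X))
    (g := fun G => setH hX (G.1 : Set X))).congr fun G => by simp)

theorem famH_empty_mem : famH hX (∅ : Set (Subcontinua X)) ∈ M :=
  Dfn.famH_mem hP hT ((Dfn.eqH (f := fun G : Subcontinua X => setH hX (G.1 : Set X))
    (g := fun G => setH hX (G.1 : Set X))).not.congr fun G => by simp)

theorem famH_starSet_mem {J : Type} [Finite J] {F : J → Closeds X}
    (hF : ∀ j, setH hX (F j : Set X) ∈ M) : famH hX (starSet (Set.range F)) ∈ M := by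
  have hpt := Dfn.range_ptH hP
  have h : Dfn M (fun (_ : Unit) (G : Subcontinua X) => setH hX (G.1 : Set X)) fun G =>
      (∃ x, x ∈ (G.1 : Set X) ∧ ∀ j, x ∈ (F j : Set X)) ∨
        ∃ j, ∀ x, x ∈ (G.1 : Set X) → x ∈ (F j : Set X) :=
    .or (.ex hpt (.and (.ptMem hX) (.all_fin fun j => have := hF j; .ptMem hX)))
      (.ex_fin fun j => have := hF j; .all hpt (.imp (.ptMem hX) (.ptMem hX)))
  refine Dfn.famH_mem hP hT (h.congr fun G => ?_)
  rw [mem_starSet]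
  simp [Set.subset_def]

theorem exists_normal_mem {F G : Closeds X} (hF : setH hX (F : Set X) ∈ M)
    (hG : setH hX (G : Set X) ∈ M) (hd : F ⊓ G = ⊥) :
    ∃ U V : Closeds X, setH hX (U : Set X) ∈ M ∧ setH hX (V : Set X) ∈ M ∧
      U ⊔ V = ⊤ ∧ U ⊓ F = ⊥ ∧ V ⊓ G = ⊥ := by
  have h : Dfn M (fun (j : Fin 2) (v : Fin 2 → Closeds X) => setH hX (v j : Set X)) fun v =>
      (∀ x, x ∈ (v 0 : Set X) ∨ x ∈ (v 1 : Set X)) ∧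
        (∀ x, ¬ (x ∈ (v 0 : Set X) ∧ x ∈ (F : Set X))) ∧
        ∀ x, ¬ (x ∈ (v 1 : Set X) ∧ x ∈ (G : Set X)) :=
    have hpt := Dfn.range_ptH hP
    .and (.all hpt (.or (.ptMem hX) (.ptMem hX))) (.and
      (.all hpt (.not (.and (.ptMem hX) (.ptMem hX))))
      (.all hpt (.not (.and (.ptMem hX) (.ptMem hX)))))
  obtain ⟨U, V, hU, hV, hFU, hGV, hUV⟩ := SeparatedNhds.of_isCompact_isCompact
    F.isClosed.isCompact G.isClosed.isCompact (Set.disjoint_iff_inter_eq_empty.2 (congrArg SetLike.coe hd))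
  obtain ⟨w, hw, h1, h2, h3⟩ := Dfn.reflect (Dfn.range_setH_closeds hP hT) h
    (v := ![⟨Uᶜ, hU.isClosed_compl⟩, ⟨Vᶜ, hV.isClosed_compl⟩])
    ⟨fun x => by
      by_contra! hx
      exact Set.disjoint_left.1 hUV (not_not.1 hx.1) (not_not.1 hx.2),
      fun x hx => hx.1 (hFU hx.2), fun x hx => hx.1 (hGV hx.2)⟩
  refine ⟨w 0, w 1, hw 0, hw 1, ?_, ?_, ?_⟩
  · exact Closeds.ext (Set.eq_univ_of_forall h1)
  · exact Closeds.ext (Set.eq_empty_of_forall_notMem h2)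
  · exact Closeds.ext (Set.eq_empty_of_forall_notMem h3)

omit [CompactSpace X] in
theorem exists_disjoint_le_mem {F G : Closeds X} (hF : setH hX (F : Set X) ∈ M)
    (hG : setH hX (G : Set X) ∈ M) (hFG : ¬ F ≤ G) :
    ∃ U : Closeds X, setH hX (U : Set X) ∈ M ∧ U ≠ ⊥ ∧ U ≤ F ∧ U ⊓ G = ⊥ := by
  have h : Dfn M (fun (_ : Unit) (v : Unit → Closeds X) => setH hX (v () : Set X)) fun v =>
      (∃ x, x ∈ (v () : Set X)) ∧ (∀ x, x ∈ (v () : Set X) → x ∈ (F : Set X)) ∧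
        ∀ x, ¬ (x ∈ (v () : Set X) ∧ x ∈ (G : Set X)) :=
    have hpt := Dfn.range_ptH hP
    .and (.ex hpt (.ptMem hX)) (.and (.all hpt (.imp (.ptMem hX) (.ptMem hX)))
      (.all hpt (.not (.and (.ptMem hX) (.ptMem hX)))))
  obtain ⟨x, hxF, hxG⟩ := Set.not_subset.1 hFG
  obtain ⟨w, hw, ⟨y, hy⟩, h2, h3⟩ := Dfn.reflect (Dfn.range_setH_closeds hP hT) h
    (v := fun _ => ⟨{x}, isClosed_singleton⟩)
    ⟨⟨x, rfl⟩, fun y hy => (Set.mem_singleton_iff.1 hy) ▸ hxF,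
      fun y hy => hxG ((Set.mem_singleton_iff.1 hy.1) ▸ hy.2)⟩
  refine ⟨w (), hw (), ?_, h2, Closeds.ext (Set.eq_empty_of_forall_notMem h3)⟩
  intro h0
  rw [h0] at hy
  exact hy

omit [CompactSpace X] [T2Space X] in
/-- If finitely many closed sets `c j` in `M` admit decompositions `a = P j ⊔ Q j` into disjoint
closed sets such that `P j` misses `c j` and the sets `P j` cover `a`, then there are such
decompositions in `M`. -/
theorem exists_splitting_mem {J : Type} [Finite J] {a : Closeds X} {c P Q : J → Closeds X}
    (ha : setH hX (a : Set X) ∈ M) (hc : ∀ j, setH hX (c j : Set X) ∈ M)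
    (hPQ : ∀ j, P j ⊔ Q j = a ∧ P j ⊓ Q j = ⊥ ∧ P j ⊓ c j = ⊥)
    (hcov : ∀ x ∈ (a : Set X), ∃ j, x ∈ (P j : Set X)) :
    ∃ P Q : J → Closeds X, (∀ j, setH hX (P j : Set X) ∈ M) ∧ (∀ j, setH hX (Q j : Set X) ∈ M) ∧
      (∀ j, P j ⊔ Q j = a ∧ P j ⊓ Q j = ⊥ ∧ P j ⊓ c j = ⊥) ∧
      ∀ x ∈ (a : Set X), ∃ j, x ∈ (P j : Set X) := by
  have hpt := Dfn.range_ptH hP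
  have hbot : ∀ F G : Closeds X, F ⊓ G = ⊥ ↔ ∀ x, ¬ (x ∈ (F : Set X) ∧ x ∈ (G : Set X)) := by
    intro F G
    rw [← SetLike.coe_set_eq, Closeds.coe_inf, Closeds.coe_bot, Set.eq_empty_iff_forall_notMem]
    rfl
  have hsup : ∀ F G : Closeds X, F ⊔ G = a ↔
      ∀ x, x ∈ (F : Set X) ∨ x ∈ (G : Set X) ↔ x ∈ (a : Set X) := by
    intro F G
    rw [← SetLike.coe_set_eq, Closeds.coe_sup, Set.ext_iff]
    rfl
  have h : Dfn M (fun (j : J ⊕ J) (v : J ⊕ J → Closeds X) => setH hX (v j : Set X)) fun v =>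
      (∀ j, (∀ x, x ∈ (v (.inl j) : Set X) ∨ x ∈ (v (.inr j) : Set X) ↔ x ∈ (a : Set X)) ∧
        (∀ x, ¬ (x ∈ (v (.inl j) : Set X) ∧ x ∈ (v (.inr j) : Set X))) ∧
        ∀ x, ¬ (x ∈ (v (.inl j) : Set X) ∧ x ∈ (c j : Set X))) ∧
      ∀ x, x ∈ (a : Set X) → ∃ j, x ∈ (v (.inl j) : Set X) := by
    refine .and (.all_fin fun j => ?_) (.all hpt (.imp (.ptMem hX) (.ex_fin fun j => .ptMem hX)))
    have := hc j
    exact .and (.all hpt (.iff (.or (.ptMem hX) (.ptMem hX)) (.ptMem hX)))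
      (.and (.all hpt (.not (.and (.ptMem hX) (.ptMem hX))))
        (.all hpt (.not (.and (.ptMem hX) (.ptMem hX)))))
  simp only [hbot, hsup] at hPQ ⊢
  obtain ⟨w, hw, h⟩ := Dfn.reflect (Dfn.range_setH_closeds hP hT) h (v := Sum.elim P Q) ⟨hPQ, hcov⟩
  exact ⟨fun j => w (.inl j), fun j => w (.inr j), fun j => hw _, fun j => hw _, h⟩

/-- A nonempty family of subcontinua in `M` has a member in `M`. -/
theorem exists_subcontinuum_mem {A : Set (Subcontinua X)} (hA : famH hX A ∈ M) (h : A.Nonempty) :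
    ∃ G ∈ A, setH hX (G.1 : Set X) ∈ M := by
  obtain ⟨G, hG⟩ := h
  obtain ⟨w, hw, h⟩ := Dfn.reflect (α := Unit) (Dfn.range_setH_subcontinua hP hT)
    (P := fun v => v () ∈ A) (Dfn.famMem hA ⟨.inl (), fun _ => rfl⟩) (v := fun _ => G) hG
  exact ⟨_, h, hw ()⟩

/-- Induction over `K* ∩ M`: every element of `K*` that belongs to `M` is generated by sets `𝓕*`
with `𝓕` a finite family of closed sets in `M`. This holds because an element of `K*` is the value
of a lattice term at closed sets, and by elementarity those may be taken in `M`. -/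
theorem latticeKStar_induction {Φ : Set (Subcontinua X) → Prop} (hempty : Φ ∅)
    (huniv : Φ Set.univ) (hunion : ∀ A B, Φ A → Φ B → Φ (A ∪ B))
    (hinter : ∀ A B, Φ A → Φ B → Φ (A ∩ B))
    (hstar : ∀ (J : Type) [Finite J] (F : J → Closeds X), (∀ j, setH hX (F j : Set X) ∈ M) →
      Φ (starSet (Set.range F)))
    {A : Set (Subcontinua X)} (hA : A ∈ latticeKStar X) (hAM : famH hX A ∈ M) : Φ A := by
  -- the values of definable operations `T` such that `T F` has property `Φ` if `F` is in `M`
  let S : Set (Set (Subcontinua X)) := {A | ∃ (J : Type) (_ : Finite J)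
    (T : (J → Closeds X) → Set (Subcontinua X)),
    Dfn M (extendCoord (fun (j : J) (v : J → Closeds X) => setH hX (v j : Set X))
      (fun G : Subcontinua X => setH hX (G.1 : Set X))) (fun p => p.2 ∈ T p.1) ∧
    (∀ F, (∀ j, setH hX (F j : Set X) ∈ M) → Φ (T F)) ∧ ∃ F, T F = A}
  have hsc := Dfn.range_setH_subcontinua hP hT
  have htriv : Dfn M (extendCoord (fun (j : Fin 0) (v : Fin 0 → Closeds X) => setH hX (v j : Set X))
      (fun G : Subcontinua X => setH hX (G.1 : Set X)))
      (fun p => setH hX (p.2.1 : Set X) = setH hX (p.2.1 : Set X)) := .eqH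
  have hS : ∀ A ∈ S, ∀ B ∈ S, A ∪ B ∈ S ∧ A ∩ B ∈ S := by
    rintro _ ⟨J, _, T, hT1, hT2, F, rfl⟩ _ ⟨J', _, T', hT1', hT2', F', rfl⟩
    have h := hT1.reindex (σ := extendCoord
      (fun (j : J ⊕ J') (v : J ⊕ J' → Closeds X) => setH hX (v j : Set X))
      (fun G : Subcontinua X => setH hX (G.1 : Set X))) (fun p => (p.1 ∘ .inl, p.2))
      (Sum.map .inl id) (by rintro (j | _) p <;> rfl)
    have h' := hT1'.reindex (σ := extendCoord
      (fun (j : J ⊕ J') (v : J ⊕ J' → Closeds X) => setH hX (v j : Set X))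
      (fun G : Subcontinua X => setH hX (G.1 : Set X))) (fun p => (p.1 ∘ .inr, p.2))
      (Sum.map .inr id) (by rintro (j | _) p <;> rfl)
    exact ⟨⟨J ⊕ J', inferInstance, fun v => T (v ∘ .inl) ∪ T' (v ∘ .inr), h.or h',
        fun F hF => hunion _ _ (hT2 _ fun j => hF _) (hT2' _ fun j => hF _), Sum.elim F F', rfl⟩,
      ⟨J ⊕ J', inferInstance, fun v => T (v ∘ .inl) ∩ T' (v ∘ .inr), h.and h',
        fun F hF => hinter _ _ (hT2 _ fun j => hF _) (hT2' _ fun j => hF _), Sum.elim F F', rfl⟩⟩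
  have hAS : A ∈ S := by
    refine Sublattice.mem_sInf.1 hA
      ⟨S, fun A hA B hB => (hS A hA B hB).1, fun A hA B hB => (hS A hA B hB).2⟩ ?_
    rintro B ((rfl | rfl) | ⟨𝓕, h𝓕, rfl⟩)
    · exact ⟨Fin 0, inferInstance, fun _ => ∅, htriv.not.congr fun p => by simp,
        fun _ _ => hempty, fun _ => ⊥, rfl⟩
    · exact ⟨Fin 0, inferInstance, fun _ => Set.univ, htriv.congr fun p => by simp,
        fun _ _ => huniv, fun _ => ⊥, rfl⟩
    · obtain ⟨n, F, -, rfl⟩ := h𝓕.fin_param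
      exact ⟨Fin n, inferInstance, fun v => starSet (Set.range v), dfn_mem_starSet hP,
        fun F hF => hstar _ F hF, F, rfl⟩
  obtain ⟨J, _, T, hT1, hT2, F, hF⟩ := hAS
  obtain ⟨w, hw, h⟩ := Dfn.reflect (Dfn.range_setH_closeds hP hT)
    (.all hsc (P := fun v G => G ∈ T v ↔ G ∈ A) (hT1.iff (Dfn.famMem hAM ⟨.inl (.inr ()), fun _ => rfl⟩)))
    (v := F) (fun G => by rw [hF])
  exact Set.ext h ▸ hT2 w hw

end

end Elementarity

end HyperspaceReflection

/-! ### Wallman spaces of bounded distributive lattices -/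

namespace HyperspaceReflection

open Topology

namespace Wallman

variable {N : Type*} [DistribLattice N]

@[simp]
theorem mem_hat {a : N} {p : Wallman N} : p ∈ hat a ↔ a ∈ p.1 := Iff.rfl

theorem isClosed_hat (a : N) : IsClosed (hat a) :=
  ⟨isOpen_generateFrom_of_mem ⟨a, rfl⟩⟩

@[simp]
theorem hat_inf (a b : N) : hat (a ⊓ b) = hat a ∩ hat b := by
  ext p
  simp

variable [BoundedOrder N]

theorem ne_univ_iff {q : Order.PFilter N} : (q : Set N) ≠ Set.univ ↔ ⊥ ∉ q := by
  rw [Ne, Set.eq_univ_iff_forall, not_iff_not]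
  exact ⟨fun h => h ⊥, fun h a => Order.PFilter.mem_of_le bot_le h⟩

theorem bot_notMem (p : Wallman N) : ⊥ ∉ p.1 := ne_univ_iff.1 p.2.1

@[simp]
theorem hat_bot : hat (⊥ : N) = ∅ := Set.eq_empty_of_forall_notMem bot_notMem

@[simp]
theorem hat_top : hat (⊤ : N) = Set.univ := Set.eq_univ_of_forall fun _ => Order.PFilter.top_mem

/-- The filter generated by a filter `q` and an element `a`. -/
def adjoin (q : Order.PFilter N) (a : N) : Order.PFilter N :=
  Order.IsPFilter.toPFilter (F := {c | ∃ b ∈ q, b ⊓ a ≤ c}) <| .of_def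
    ⟨⊤, ⊤, Order.PFilter.top_mem, le_top⟩
    (fun c ⟨b, hb, hc⟩ d ⟨b', hb', hd⟩ => ⟨c ⊓ d, ⟨b ⊓ b', Order.PFilter.inf_mem hb hb',
      le_inf ((inf_le_inf_right a inf_le_left).trans hc)
        ((inf_le_inf_right a inf_le_right).trans hd)⟩, inf_le_left, inf_le_right⟩)
    (fun hcd ⟨b, hb, hc⟩ => ⟨b, hb, hc.trans hcd⟩)

theorem mem_adjoin {q : Order.PFilter N} {a c : N} : c ∈ adjoin q a ↔ ∃ b ∈ q, b ⊓ a ≤ c := Iff.rfl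

theorem exists_disjoint_of_notMem {p : Wallman N} {a : N} (h : a ∉ p.1) :
    ∃ b ∈ p.1, b ⊓ a = ⊥ := by
  by_contra! hb
  have hle : p.1 ≤ adjoin p.1 a := fun c hc => mem_adjoin.2 ⟨c, hc, inf_le_left⟩
  have hp : (adjoin p.1 a : Set N) ≠ Set.univ := ne_univ_iff.2 fun h => by
    obtain ⟨b, hbp, h⟩ := mem_adjoin.1 h
    exact hb b hbp (le_bot_iff.1 h)
  exact h (p.2.2 hp hle (mem_adjoin.2 ⟨⊤, Order.PFilter.top_mem, inf_le_right⟩))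

@[simp]
theorem hat_sup (a b : N) : hat (a ⊔ b) = hat a ∪ hat b := by
  ext p
  refine ⟨fun h => ?_, fun h => h.elim (Order.PFilter.mem_of_le le_sup_left)
    (Order.PFilter.mem_of_le le_sup_right)⟩
  by_contra! hab
  simp only [Set.mem_union, not_or, mem_hat] at hab
  obtain ⟨c, hc, hca⟩ := exists_disjoint_of_notMem hab.1
  obtain ⟨d, hd, hdb⟩ := exists_disjoint_of_notMem hab.2
  refine bot_notMem p ?_
  have h1 : (c ⊓ d) ⊓ (a ⊔ b) = ⊥ := by
    rw [inf_sup_left, inf_right_comm, hca, inf_assoc, hdb]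
    simp
  rw [← h1]
  exact Order.PFilter.inf_mem (Order.PFilter.inf_mem hc hd) h

/-- Every proper filter is contained in an ultrafilter. -/
theorem exists_le {q : Order.PFilter N} (hq : ⊥ ∉ q) : ∃ p : Wallman N, q ≤ p.1 := by
  obtain ⟨p, hqp, hp⟩ := zorn_le_nonempty₀ {r : Order.PFilter N | ⊥ ∉ r} (fun C hC hchain r hr => by
    refine ⟨Order.IsPFilter.toPFilter (F := ⋃ s ∈ C, (s : Set N)) (.of_def ?_ ?_ ?_), ?_, ?_⟩
    · exact ⟨⊤, Set.mem_biUnion hr Order.PFilter.top_mem⟩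
    · intro a ha b hb
      simp only [Set.mem_iUnion, exists_prop] at ha hb
      obtain ⟨s, hs, ha⟩ := ha
      obtain ⟨t, ht, hb⟩ := hb
      rcases hchain.total hs ht with h | h
      · exact ⟨a ⊓ b, Set.mem_biUnion ht (Order.PFilter.inf_mem (h ha) hb), inf_le_left,
          inf_le_right⟩
      · exact ⟨a ⊓ b, Set.mem_biUnion hs (Order.PFilter.inf_mem ha (h hb)), inf_le_left,
          inf_le_right⟩
    · intro a b hab ha
      simp only [Set.mem_iUnion, exists_prop] at ha ⊢
      obtain ⟨s, hs, ha⟩ := ha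
      exact ⟨s, hs, Order.PFilter.mem_of_le hab ha⟩
    · intro h
      obtain ⟨s, hs, h⟩ := Set.mem_iUnion₂.1 h
      exact hC hs h
    · intro s hs a ha
      exact Set.mem_biUnion hs ha) q hq
  refine ⟨⟨p, ?_⟩, hqp⟩
  simpa only [ne_univ_iff] using! hp

theorem exists_mem_hat {a : N} (ha : a ≠ ⊥) : ∃ p : Wallman N, a ∈ p.1 := by
  obtain ⟨p, hp⟩ := exists_le (q := Order.PFilter.principal a) (by simpa using ha)
  exact ⟨p, hp (by simp)⟩

theorem hat_eq_empty {a : N} : hat a = ∅ ↔ a = ⊥ := by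
  refine ⟨fun h => ?_, fun h => by simp [h]⟩
  by_contra ha
  obtain ⟨p, hp⟩ := exists_mem_hat ha
  exact Set.eq_empty_iff_forall_notMem.1 h p hp

theorem inf_eq_bot_iff {a b : N} : a ⊓ b = ⊥ ↔ hat a ∩ hat b = ∅ := by
  rw [← hat_inf, hat_eq_empty]

instance : CompactSpace (Wallman N) := by
  refine compactSpace_generateFrom rfl fun P hP hcov => ?_
  let S : Set N := {a | (hat a)ᶜ ∈ P}
  -- there is no ultrafilter containing `S`, so the filter generated by `S` is not proper
  by_cases h : ∃ t : Finset N, (t : Set N) ⊆ S ∧ t.inf id = ⊥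
  · obtain ⟨t, ht, h⟩ := h
    refine ⟨(fun a => (hat a)ᶜ) '' t, ?_, t.finite_toSet.image _, ?_⟩
    · rintro _ ⟨a, ha, rfl⟩
      exact ht ha
    · refine Set.eq_univ_of_forall fun p => ?_
      by_contra hp
      refine bot_notMem p ?_
      rw [← h]
      have : ∀ s : Finset N, s ⊆ t → s.inf id ∈ p.1 := by
        intro s
        classical
        induction s using Finset.induction_on with
        | empty => intro _; simp
        | insert a s ha ih =>
          intro hs
          rw [Finset.inf_insert]
          refine Order.PFilter.inf_mem ?_ (ih ((Finset.subset_insert a s).trans hs))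
          by_contra hap
          exact hp ⟨_, ⟨a, hs (Finset.mem_insert_self a s), rfl⟩, hap⟩
      exact this t subset_rfl
  · push Not at h
    let q : Order.PFilter N := Order.IsPFilter.toPFilter
      (F := {c | ∃ t : Finset N, (t : Set N) ⊆ S ∧ t.inf id ≤ c}) <| .of_def
        ⟨⊤, ∅, by simp⟩ (by
          classical
          rintro c ⟨t, ht, hc⟩ d ⟨t', ht', hd⟩
          refine ⟨c ⊓ d, ⟨t ∪ t', by simp [ht, ht'], ?_⟩, inf_le_left, inf_le_right⟩
          rw [Finset.inf_union]
          exact inf_le_inf hc hd)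
        (fun hcd ⟨t, ht, hc⟩ => ⟨t, ht, hc.trans hcd⟩)
    obtain ⟨p, hp⟩ := exists_le (q := q) fun ⟨t, ht, hb⟩ => h t ht (le_bot_iff.1 hb)
    obtain ⟨U, hU, hpU⟩ : p ∈ ⋃₀ P := hcov ▸ trivial
    obtain ⟨a, rfl⟩ := hP hU
    refine absurd (hp (show a ∈ q from ⟨{a}, by simpa using! hU, by simp⟩)) hpU

omit [BoundedOrder N] in
theorem secondCountableTopology [Countable N] : SecondCountableTopology (Wallman N) :=
  ⟨_, Set.countable_range fun a : N => (hat a)ᶜ, by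
    change generateFrom _ = _
    congr 1
    ext U
    exact ⟨fun ⟨a, h⟩ => ⟨a, h.symm⟩, fun ⟨a, h⟩ => ⟨a, h.symm⟩⟩⟩

/-- The representation of a compact space as a Wallman space: a lattice homomorphism `φ` from `N` to
the closed subsets of a compact space `Y` that kills only `⊥`, and whose values separate the
points of `Y` in the sense of Hausdorff, yields a homeomorphism from the Wallman space of `N` to
`Y`. -/
theorem nonempty_homeomorph {Y : Type*} [TopologicalSpace Y] [CompactSpace Y] (φ : N → Set Y)
    (hcl : ∀ a, IsClosed (φ a)) (hinf : ∀ a b, φ (a ⊓ b) = φ a ∩ φ b)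
    (hsup : ∀ a b, φ (a ⊔ b) = φ a ∪ φ b) (htop : φ ⊤ = Set.univ)
    (hbot : ∀ a, φ a = ∅ ↔ a = ⊥)
    (hsep : ∀ y z, y ≠ z → ∃ a b, φ a ∪ φ b = Set.univ ∧ y ∉ φ a ∧ z ∉ φ b) :
    Nonempty (Wallman N ≃ₜ Y) := by
  have hmono : ∀ a b, a ≤ b → φ a ⊆ φ b := fun a b h => by
    rw [← sup_eq_right.2 h, hsup]
    exact Set.subset_union_left
  have hsep' : ∀ y a, y ∉ φ a → ∃ b, y ∈ φ b ∧ φ b ∩ φ a = ∅ := by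
    intro y a hy
    have key : ∃ b, y ∈ φ b ∧ φ a ∩ φ b = ∅ := by
      refine (hcl a).isCompact.induction_on (p := fun s => ∃ b, y ∈ φ b ∧ s ∩ φ b = ∅)
        ⟨⊤, by simp [htop], by simp⟩ ?_ ?_ ?_
      · rintro s t hst ⟨b, hyb, hb⟩
        exact ⟨b, hyb, Set.subset_empty_iff.1 (hb ▸ Set.inter_subset_inter_left _ hst)⟩
      · rintro s t ⟨b, hyb, hb⟩ ⟨c, hyc, hc⟩
        refine ⟨b ⊓ c, by simp [hinf, hyb, hyc], ?_⟩
        rw [hinf, Set.union_inter_distrib_right, ← Set.inter_assoc, hb, Set.inter_comm (φ b),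
          ← Set.inter_assoc, hc]
        simp
      · intro z hz
        have hyz : z ≠ y := by
          rintro rfl
          exact hy hz
        obtain ⟨b, c, hbc, hzb, hyc⟩ := hsep z y hyz
        refine ⟨(φ b)ᶜ, mem_nhdsWithin_of_mem_nhds ((hcl b).isOpen_compl.mem_nhds hzb), b, ?_,
          by simp⟩
        exact ((hbc ▸ trivial : y ∈ φ b ∪ φ c)).resolve_right hyc
    obtain ⟨b, hb, h⟩ := key
    exact ⟨b, hb, by rwa [Set.inter_comm]⟩
  have hbot' : φ ⊥ = ∅ := (hbot ⊥).2 rfl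
  let F (y : Y) : Order.PFilter N := Order.IsPFilter.toPFilter (F := {a | y ∈ φ a}) <| .of_def
    ⟨⊤, by simp [htop]⟩ (fun a ha b hb => ⟨a ⊓ b, by
      rw [Set.mem_ofPred_eq, hinf]
      exact ⟨ha, hb⟩, inf_le_left, inf_le_right⟩)
    (fun hab ha => hmono _ _ hab ha)
  have hF : ∀ y a, a ∈ F y ↔ y ∈ φ a := fun _ _ => Iff.rfl
  let f (y : Y) : Wallman N := ⟨F y, by
    refine ⟨ne_univ_iff.2 fun h => ?_, fun q hq hle a ha => ?_⟩
    · rw [hF, hbot'] at h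
      exact h
    · by_contra hya
      obtain ⟨b, hyb, hb⟩ := hsep' y a hya
      refine ne_univ_iff.1 hq ?_
      rw [← (hbot (b ⊓ a)).1 ((hinf b a).trans hb)]
      exact Order.PFilter.inf_mem (hle hyb) ha⟩
  have hpre : ∀ a, f ⁻¹' hat a = φ a := fun _ => rfl
  have hcont : Continuous f := by
    refine continuous_generateFrom_iff.2 ?_
    rintro _ ⟨a, rfl⟩
    rw [Set.preimage_compl, hpre]
    exact (hcl a).isOpen_compl
  have hsurj : f.Surjective := by
    intro p
    have hne : (⋂ a : p.1, φ a).Nonempty := by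
      have : Nonempty p.1 := ⟨⟨⊤, Order.PFilter.top_mem⟩⟩
      refine IsCompact.nonempty_iInter_of_directed_nonempty_isCompact_isClosed _ ?_ ?_
        (fun a => (hcl a).isCompact) (fun a => hcl a)
      · rintro ⟨a, ha⟩ ⟨b, hb⟩
        refine ⟨⟨a ⊓ b, Order.PFilter.inf_mem ha hb⟩, ?_, ?_⟩
        · exact hmono _ _ inf_le_left
        · exact hmono _ _ inf_le_right
      · rintro ⟨a, ha⟩
        rw [Set.nonempty_iff_ne_empty, Ne, hbot]
        rintro rfl
        exact bot_notMem p ha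
    obtain ⟨y, hy⟩ := hne
    refine ⟨y, Subtype.ext ?_⟩
    have hle : p.1 ≤ (f y).1 := fun a ha => Set.mem_iInter.1 hy ⟨a, ha⟩
    exact le_antisymm (p.2.2 (f y).2.1 hle) hle
  have hT2 : ∀ y z, y ≠ z → ∃ a b, hat a ∪ hat b = Set.univ ∧ f y ∉ hat a ∧ f z ∉ hat b := by
    intro y z hyz
    obtain ⟨a, b, hab, hya, hzb⟩ := hsep y z hyz
    refine ⟨a, b, ?_, hya, hzb⟩
    refine Set.eq_univ_of_forall fun p => ?_
    obtain ⟨w, rfl⟩ := hsurj p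
    exact (hab ▸ trivial : w ∈ φ a ∪ φ b)
  have hinj : f.Injective := by
    intro y z h
    by_contra hyz
    obtain ⟨a, b, hab, hya, hzb⟩ := hT2 y z hyz
    rw [h] at hya
    exact (hab ▸ trivial : f z ∈ hat a ∪ hat b).elim hya hzb
  have : T2Space (Wallman N) := by
    refine ⟨fun p q hpq => ?_⟩
    obtain ⟨y, rfl⟩ := hsurj p
    obtain ⟨z, rfl⟩ := hsurj q
    obtain ⟨a, b, hab, hya, hzb⟩ := hT2 y z fun h => hpq (congrArg f h)
    exact ⟨(hat a)ᶜ, (hat b)ᶜ, (isClosed_hat a).isOpen_compl, (isClosed_hat b).isOpen_compl, hya,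
      hzb, Set.disjoint_left.2 fun w hwa hwb => (hab ▸ trivial : w ∈ hat a ∪ hat b).elim hwa hwb⟩
  exact ⟨(hcont.homeoOfEquivCompactToT2 (f := Equiv.ofBijective f ⟨hinj, hsurj⟩)).symm⟩

end Wallman

end HyperspaceReflection

/-! ### Wallman spaces of normal and disjunctive lattices -/

namespace HyperspaceReflection

open Topology

/-- A bounded lattice is normal if disjoint elements can be separated: the lattice-theoretic form of
normality of a topological space, for the lattice of closed sets. -/
def IsNormalLattice (N : Type*) [Lattice N] [BoundedOrder N] : Prop :=
  ∀ a b : N, a ⊓ b = ⊥ → ∃ u v : N, u ⊔ v = ⊤ ∧ u ⊓ a = ⊥ ∧ v ⊓ b = ⊥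

/-- A bounded lattice is disjunctive if `a ≰ b` is always witnessed by a nonzero element below `a`
that is disjoint from `b`. -/
def IsDisjunctive (N : Type*) [Lattice N] [BoundedOrder N] : Prop :=
  ∀ a b : N, ¬ a ≤ b → ∃ c : N, c ≠ ⊥ ∧ c ≤ a ∧ c ⊓ b = ⊥

namespace Wallman

variable {N : Type*} [DistribLattice N] [BoundedOrder N]

theorem hat_subset_hat (hd : IsDisjunctive N) {a b : N} : hat a ⊆ hat b ↔ a ≤ b := by
  refine ⟨fun h => ?_, fun h p hp => Order.PFilter.mem_of_le h hp⟩
  by_contra hab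
  obtain ⟨c, hc, hca, hcb⟩ := hd a b hab
  obtain ⟨p, hp⟩ := exists_mem_hat hc
  refine bot_notMem p ?_
  rw [← hcb]
  exact Order.PFilter.inf_mem hp (h (Order.PFilter.mem_of_le hca hp))

theorem mem_nhds_of_sup_eq_top {a b : N} (h : a ⊔ b = ⊤) {p : Wallman N} (hp : p ∉ hat a) :
    hat b ∈ 𝓝 p := by
  refine Filter.mem_of_superset ((isClosed_hat a).isOpen_compl.mem_nhds hp) fun q hq => ?_
  have : q ∈ hat (a ⊔ b) := by simp [h]
  rw [hat_sup] at this
  exact this.resolve_left hq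

theorem notMem_of_inf_eq_bot {a b : N} (h : a ⊓ b = ⊥) {p : Wallman N} (hp : p ∈ hat b) :
    p ∉ hat a := fun hpa => bot_notMem p (h ▸ Order.PFilter.inf_mem hpa hp)

theorem exists_hat_mem_nhds (hn : IsNormalLattice N) {p q : Wallman N} (hpq : p ≠ q) :
    ∃ a b : N, a ⊓ b = ⊥ ∧ hat a ∈ 𝓝 p ∧ hat b ∈ 𝓝 q := by
  have : ∃ c ∈ p.1, c ∉ q.1 := by
    by_contra! h
    exact hpq (Subtype.ext (le_antisymm h (p.2.2 q.2.1 h)))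
  obtain ⟨c, hc, hcq⟩ := this
  obtain ⟨d, hd, hdc⟩ := exists_disjoint_of_notMem hcq
  obtain ⟨u, v, huv, hud, hvc⟩ := hn d c hdc
  obtain ⟨u', v', huv', huv₁, hvc'⟩ := hn c v (by rwa [inf_comm])
  exact ⟨v', v, hvc', mem_nhds_of_sup_eq_top huv' (notMem_of_inf_eq_bot huv₁ hc),
    mem_nhds_of_sup_eq_top huv (notMem_of_inf_eq_bot hud hd)⟩

theorem t2Space (hn : IsNormalLattice N) : T2Space (Wallman N) := by
  refine t2Space_iff_disjoint_nhds.2 fun p q hpq => ?_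
  obtain ⟨a, b, hab, ha, hb⟩ := exists_hat_mem_nhds hn hpq
  exact Filter.disjoint_of_disjoint_of_mem
    (Set.disjoint_iff_inter_eq_empty.2 (inf_eq_bot_iff.1 hab)) ha hb

/-- Disjoint closed subsets of the Wallman space of a normal lattice are covered by disjoint basic
closed sets. -/
theorem exists_subset_hat (hn : IsNormalLattice N) {s t : Set (Wallman N)} (hs : IsClosed s)
    (ht : IsClosed t) (hst : Disjoint s t) : ∃ a b : N, a ⊓ b = ⊥ ∧ s ⊆ hat a ∧ t ⊆ hat b := by
  refine ht.isCompact.induction_on (p := fun t => ∃ a b : N, a ⊓ b = ⊥ ∧ s ⊆ hat a ∧ t ⊆ hat b)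
    ⟨⊤, ⊥, by simp⟩ ?_ ?_ ?_
  · rintro t t' htt' ⟨a, b, hab, ha, hb⟩
    exact ⟨a, b, hab, ha, htt'.trans hb⟩
  · rintro t t' ⟨a, b, hab, ha, hb⟩ ⟨a', b', hab', ha', hb'⟩
    refine ⟨a ⊓ a', b ⊔ b', ?_, by simp [ha, ha'], ?_⟩
    · rw [inf_sup_left, inf_right_comm, hab, inf_assoc, hab']
      simp
    · rw [hat_sup]
      exact Set.union_subset_union hb hb'
  intro q hq
  have key : ∃ a b : N, a ⊓ b = ⊥ ∧ s ⊆ hat a ∧ hat b ∈ 𝓝 q := by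
    refine hs.isCompact.induction_on
      (p := fun s => ∃ a b : N, a ⊓ b = ⊥ ∧ s ⊆ hat a ∧ hat b ∈ 𝓝 q) ⟨⊥, ⊤, by simp⟩ ?_ ?_ ?_
    · rintro s s' hss' ⟨a, b, hab, ha, hb⟩
      exact ⟨a, b, hab, hss'.trans ha, hb⟩
    · rintro s s' ⟨a, b, hab, ha, hb⟩ ⟨a', b', hab', ha', hb'⟩
      refine ⟨a ⊔ a', b ⊓ b', ?_, ?_, ?_⟩
      · rw [inf_sup_right, ← inf_assoc, hab, inf_left_comm, hab']
        simp
      · rw [hat_sup]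
        exact Set.union_subset_union ha ha'
      · rw [hat_inf]
        exact Filter.inter_mem hb hb'
    · intro p hp
      obtain ⟨a, b, hab, ha, hb⟩ := exists_hat_mem_nhds hn (Set.disjoint_iff_forall_ne.1 hst hp hq)
      exact ⟨hat a, mem_nhdsWithin_of_mem_nhds ha, a, b, hab, subset_rfl, hb⟩
  obtain ⟨a, b, hab, ha, hb⟩ := key
  exact ⟨hat b, mem_nhdsWithin_of_mem_nhds hb, a, b, hab, ha, subset_rfl⟩

/-- A basic closed set is connected as soon as its index is connected in the lattice. -/
theorem isPreconnected_hat (hn : IsNormalLattice N) (hd : IsDisjunctive N) {a : N}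
    (h : ∀ b c : N, b ⊓ c = ⊥ → a ≤ b ⊔ c → a ≤ b ∨ a ≤ c) : IsPreconnected (hat a) := by
  refine (isPreconnected_iff_subset_of_fully_disjoint_closed (isClosed_hat a)).2 ?_
  intro s t hs ht hst hdisj
  obtain ⟨b, c, hbc, hsb, htc⟩ := exists_subset_hat hn hs ht hdisj
  have hle : a ≤ b ⊔ c := by
    rw [← hat_subset_hat hd, hat_sup]
    exact hst.trans (Set.union_subset_union hsb htc)
  have hempty := inf_eq_bot_iff.1 hbc
  refine (h b c hbc hle).imp (fun hab p hp => ?_) (fun hac p hp => ?_)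
  · refine (hst hp).resolve_right fun hpt => ?_
    exact Set.eq_empty_iff_forall_notMem.1 hempty p ⟨(hat_subset_hat hd).2 hab hp, htc hpt⟩
  · refine (hst hp).resolve_left fun hps => ?_
    exact Set.eq_empty_iff_forall_notMem.1 hempty p ⟨hsb hps, (hat_subset_hat hd).2 hac hp⟩

theorem metrizableSpace (hn : IsNormalLattice N) [Countable N] : MetrizableSpace (Wallman N) := by
  have := t2Space hn
  have := secondCountableTopology (N := N)
  infer_instance

end Wallman

end HyperspaceReflection

/-! ### The hyperspace of subcontinua -/

namespace HyperspaceReflection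

open Topology

section Hyperspace

variable {Y : Type*} [TopologicalSpace Y]

theorem isClosed_starSet {𝓕 : Set (Closeds Y)} (h𝓕 : 𝓕.Finite) : IsClosed (starSet 𝓕) := by
  have h : starSet 𝓕 = Subtype.val ⁻¹' ({G : NonemptyCompacts Y |
      ((G : Set Y) ∩ ⋂ F ∈ 𝓕, (F : Set Y)).Nonempty} ∪
        ⋃ F ∈ 𝓕, {G : NonemptyCompacts Y | (G : Set Y) ⊆ F}) := by
    ext G
    rw [mem_starSet]
    simp [Set.Nonempty]
  rw [h]
  refine IsClosed.preimage continuous_subtype_val (.union ?_ ?_)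
  · exact NonemptyCompacts.isClosed_inter_nonempty_of_isClosed
      (isClosed_biInter fun F _ => F.isClosed)
  · exact h𝓕.isClosed_biUnion fun F _ => NonemptyCompacts.isClosed_subsets_of_isClosed F.isClosed

variable [T2Space Y]

theorem isClosed_setOf_isConnected :
    IsClosed {G : NonemptyCompacts Y | IsConnected (G : Set Y)} := by
  refine isOpen_compl_iff.1 (isOpen_iff_forall_mem_open.2 fun G hG => ?_)
  have hG' : ¬ IsPreconnected (G : Set Y) := fun h => hG ⟨G.nonempty, h⟩
  rw [isPreconnected_iff_subset_of_fully_disjoint_closed G.isCompact.isClosed] at hG'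
  push Not at hG'
  obtain ⟨s, t, hs, ht, hst, hd, hGs, hGt⟩ := hG'
  obtain ⟨U, V, hU, hV, hsU, htV, hUV⟩ := SeparatedNhds.of_isCompact_isCompact
    (G.isCompact.inter_right hs) (G.isCompact.inter_right ht)
    (hd.mono Set.inter_subset_right Set.inter_subset_right)
  refine ⟨{H | (H : Set Y) ⊆ U ∪ V} ∩ ({H | ((H : Set Y) ∩ U).Nonempty} ∩
    {H | ((H : Set Y) ∩ V).Nonempty}), ?_, ?_, ?_, ?_, ?_⟩
  · rintro H ⟨hH, hHU, hHV⟩ hc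
    obtain ⟨x, -, hxU, hxV⟩ := hc.2 U V hU hV hH hHU hHV
    exact Set.disjoint_left.1 hUV hxU hxV
  · exact (NonemptyCompacts.isOpen_subsets_of_isOpen (hU.union hV)).inter
      ((NonemptyCompacts.isOpen_inter_nonempty_of_isOpen hU).inter
        (NonemptyCompacts.isOpen_inter_nonempty_of_isOpen hV))
  · exact fun x hx => (hst hx).imp (fun h => hsU ⟨hx, h⟩) fun h => htV ⟨hx, h⟩
  · obtain ⟨x, hx, hxt⟩ := Set.not_subset.1 hGt
    exact ⟨x, hx, hsU ⟨hx, (hst hx).resolve_right hxt⟩⟩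
  · obtain ⟨x, hx, hxs⟩ := Set.not_subset.1 hGs
    exact ⟨x, hx, htV ⟨hx, (hst hx).resolve_left hxs⟩⟩

variable [CompactSpace Y]

instance : CompactSpace (Subcontinua Y) :=
  isCompact_iff_compactSpace.1 isClosed_setOf_isConnected.isCompact

omit [CompactSpace Y] in
/-- If the closed sets `b i` separate points from closed sets, then the sets `𝓕*`, with `𝓕` formed
by sets `b i`, separate the points of the hyperspace of subcontinua. -/
theorem exists_starSet_separation {ι : Type*} {b : ι → Closeds Y} {i₀ : ι} (h₀ : b i₀ = ⊥)
    (hb : ∀ (y : Y) (F : Closeds Y), y ∉ (F : Set Y) →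
      ∃ i j, b i ⊔ b j = ⊤ ∧ y ∉ (b i : Set Y) ∧ b j ⊓ F = ⊥)
    {G H : Subcontinua Y} (hGH : G ≠ H) : ∃ (m n : ℕ) (f : Fin m → ι) (g : Fin n → ι),
      starSet (Set.range (b ∘ f)) ∪ starSet (Set.range (b ∘ g)) = Set.univ ∧
        G ∉ starSet (Set.range (b ∘ f)) ∧ H ∉ starSet (Set.range (b ∘ g)) := by
  have key : ∀ {G H : Subcontinua Y} {y : Y}, y ∈ (G.1 : Set Y) → y ∉ (H.1 : Set Y) →
      ∃ (f : Fin 2 → ι) (g : Fin 1 → ι),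
        starSet (Set.range (b ∘ f)) ∪ starSet (Set.range (b ∘ g)) = Set.univ ∧
          G ∉ starSet (Set.range (b ∘ f)) ∧ H ∉ starSet (Set.range (b ∘ g)) := by
    intro G H y hyG hyH
    obtain ⟨i, j, hij, hy, hj⟩ := hb y ⟨H.1, H.1.isCompact.isClosed⟩ hyH
    have hj' : ∀ x ∈ (b j : Set Y), x ∉ (H.1 : Set Y) := fun x hx hxH =>
      Set.eq_empty_iff_forall_notMem.1 (congrArg SetLike.coe hj) x ⟨hx, hxH⟩
    have hij' : ∀ x, x ∈ (b i : Set Y) ∨ x ∈ (b j : Set Y) := fun x =>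
      Set.eq_univ_iff_forall.1 (congrArg SetLike.coe hij) x
    have h₀' : ∀ x, x ∉ (b i₀ : Set Y) := fun x => by simp [h₀]
    -- the first set consists of the continua inside `b i`, the second of those that meet `b j`
    have h1 : ∀ K : Subcontinua Y, K ∈ starSet (Set.range (b ∘ ![i, i₀])) ↔
        (K.1 : Set Y) ⊆ b i := fun K => by
      have hne : ¬ (K.1 : Set Y) ⊆ b i₀ := fun h => K.2.1.elim fun x hx => h₀' x (h hx)
      rw [mem_starSet]
      refine ⟨?_, fun h => .inr ⟨b i, ⟨0, rfl⟩, h⟩⟩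
      rintro (⟨x, -, hF⟩ | ⟨_, ⟨k, rfl⟩, h⟩)
      · exact (h₀' x (hF _ ⟨1, rfl⟩)).elim
      · fin_cases k
        · exact h
        · exact (hne h).elim
    have h2 : ∀ K : Subcontinua Y, K ∈ starSet (Set.range (b ∘ ![j])) ↔
        ((K.1 : Set Y) ∩ b j).Nonempty := fun K => by
      rw [mem_starSet]
      constructor
      · rintro (⟨x, hx, hF⟩ | ⟨_, ⟨k, rfl⟩, h⟩)
        · exact ⟨x, hx, hF _ ⟨0, rfl⟩⟩
        · obtain ⟨x, hx⟩ := K.2.1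
          fin_cases k
          exact ⟨x, hx, h hx⟩
      · rintro ⟨x, hx, hxj⟩
        refine .inl ⟨x, hx, ?_⟩
        rintro _ ⟨k, rfl⟩
        fin_cases k
        exact hxj
    refine ⟨![i, i₀], ![j], Set.eq_univ_of_forall fun K => ?_, ?_, ?_⟩
    · rw [Set.mem_union, h1, h2]
      by_contra! hK
      obtain ⟨x, hx, hxi⟩ := Set.not_subset.1 hK.1
      exact Set.eq_empty_iff_forall_notMem.1 hK.2 x ⟨hx, (hij' x).resolve_left hxi⟩
    · rw [h1]
      exact fun h => hy (h hyG)
    · rw [h2]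
      rintro ⟨x, hx, hxj⟩
      exact hj' x hxj hx
  by_cases hsub : (G.1 : Set Y) ⊆ H.1
  · obtain ⟨y, hyH, hyG⟩ := Set.not_subset.1 fun h : (H.1 : Set Y) ⊆ G.1 =>
      hGH (Subtype.ext (SetLike.coe_injective (hsub.antisymm h)))
    obtain ⟨f, g, h1, h2, h3⟩ := key hyH hyG
    exact ⟨_, _, g, f, by rwa [Set.union_comm], h3, h2⟩
  · obtain ⟨y, hyG, hyH⟩ := Set.not_subset.1 hsub
    obtain ⟨f, g, h⟩ := key hyG hyH
    exact ⟨_, _, f, g, h⟩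

/-- If no subcontinuum of `a` meets all the closed sets `c j`, then `a` is covered by sets `P j`
that are relatively clopen in `a` and miss `c j`. This holds since the components of a compact
Hausdorff space are intersections of clopen sets. -/
theorem exists_splitting {J : Type*} [Finite J] {a : Closeds Y} {c : J → Closeds Y}
    (h : ∀ G : Subcontinua Y, (G.1 : Set Y) ⊆ a → ∃ j, (G.1 : Set Y) ∩ c j = ∅) :
    ∃ P Q : J → Closeds Y, (∀ j, P j ⊔ Q j = a ∧ P j ⊓ Q j = ⊥ ∧ P j ⊓ c j = ⊥) ∧
      ∀ x ∈ (a : Set Y), ∃ j, x ∈ (P j : Set Y) := by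
  have : CompactSpace a := isCompact_iff_compactSpace.1 a.isClosed.isCompact
  have hc : ∀ j, IsClosed {x : a | (x : Y) ∈ (c j : Set Y)} := fun j =>
    (c j).isClosed.preimage continuous_subtype_val
  have hpt : ∀ x : a, ∃ j, ∃ W : Set a, IsClopen W ∧ x ∈ W ∧
      W ∩ {x : a | (x : Y) ∈ (c j : Set Y)} = ∅ := by
    intro x
    have himg : IsCompact (Subtype.val '' connectedComponent x : Set Y) :=
      isClosed_connectedComponent.isCompact.image continuous_subtype_val
    obtain ⟨j, hj⟩ := h ⟨⟨⟨_, himg⟩, ⟨x, x, mem_connectedComponent, rfl⟩⟩,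
      isConnected_connectedComponent.image _ continuous_subtype_val.continuousOn⟩ (by
        rintro _ ⟨y, -, rfl⟩
        exact y.2)
    refine ⟨j, ?_⟩
    have hemp : {x : a | (x : Y) ∈ (c j : Set Y)} ∩
        ⋂ s : { s : Set a // IsClopen s ∧ x ∈ s }, (s : Set a) = ∅ := by
      rw [← connectedComponent_eq_iInter_isClopen]
      refine Set.eq_empty_of_forall_notMem fun y hy => ?_
      exact Set.eq_empty_iff_forall_notMem.1 hj y ⟨⟨y, hy.2, rfl⟩, hy.1⟩
    have : Nonempty { s : Set a // IsClopen s ∧ x ∈ s } := ⟨⟨Set.univ, isClopen_univ, trivial⟩⟩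
    obtain ⟨W, hW⟩ := (hc j).isCompact.elim_directed_family_closed
      (fun s : { s : Set a // IsClopen s ∧ x ∈ s } => (s : Set a)) (fun s => s.2.1.isClosed) hemp
      (fun s t => ⟨⟨s ∩ t, s.2.1.inter t.2.1, s.2.2, t.2.2⟩, Set.inter_subset_left,
        Set.inter_subset_right⟩)
    exact ⟨W, W.2.1, W.2.2, by rwa [Set.inter_comm]⟩
  have hcov : ∃ W : J → Set a, (∀ j, IsClopen (W j) ∧
      W j ∩ {x : a | (x : Y) ∈ (c j : Set Y)} = ∅) ∧ Set.univ ⊆ ⋃ j, W j := by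
    refine isCompact_univ.induction_on (p := fun s => ∃ W : J → Set a, (∀ j, IsClopen (W j) ∧
      W j ∩ {x : a | (x : Y) ∈ (c j : Set Y)} = ∅) ∧ s ⊆ ⋃ j, W j)
      ⟨fun _ => ∅, by simp [isClopen_empty], by simp⟩ ?_ ?_ ?_
    · rintro s t hst ⟨W, hW, ht⟩
      exact ⟨W, hW, hst.trans ht⟩
    · rintro s t ⟨W, hW, hs⟩ ⟨W', hW', ht⟩
      refine ⟨fun j => W j ∪ W' j, fun j => ⟨(hW j).1.union (hW' j).1, ?_⟩, ?_⟩
      · rw [Set.union_inter_distrib_right, (hW j).2, (hW' j).2, Set.union_empty]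
      · rw [Set.iUnion_union_distrib]
        exact Set.union_subset_union hs ht
    · intro x _
      classical
      obtain ⟨j, W, hW, hxW, hWc⟩ := hpt x
      refine ⟨W, mem_nhdsWithin_of_mem_nhds (hW.isOpen.mem_nhds hxW),
        fun i => if i = j then W else ∅, fun i => ?_, fun y hy => ?_⟩
      · by_cases hi : i = j
        · subst hi
          simpa [hW] using hWc
        · simp [hi, isClopen_empty]
      · exact Set.mem_iUnion.2 ⟨j, by simpa using hy⟩
  obtain ⟨W, hW, hcov⟩ := hcov
  have hcl : ∀ s : Set a, IsClosed s → IsClosed (Subtype.val '' s : Set Y) := fun s hs =>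
    (a.isClosed.isClosedEmbedding_subtypeVal).isClosedMap s hs
  refine ⟨fun j => ⟨_, hcl _ (hW j).1.isClosed⟩, fun j => ⟨_, hcl _ (hW j).1.compl.isClosed⟩,
    fun j => ⟨?_, ?_, ?_⟩, fun x hx => ?_⟩
  · refine Closeds.ext ?_
    change Subtype.val '' W j ∪ Subtype.val '' (W j)ᶜ = (a : Set Y)
    rw [← Set.image_union, Set.union_compl_self, Set.image_univ]
    exact Subtype.range_coe
  · refine Closeds.ext ?_
    change Subtype.val '' W j ∩ Subtype.val '' (W j)ᶜ = ∅
    rw [← Set.image_inter Subtype.val_injective, Set.inter_compl_self, Set.image_empty]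
  · refine Closeds.ext (Set.eq_empty_of_forall_notMem ?_)
    rintro _ ⟨⟨y, hy, rfl⟩, hyc⟩
    exact Set.eq_empty_iff_forall_notMem.1 (hW j).2 y ⟨hy, hyc⟩
  · obtain ⟨j, hj⟩ := Set.mem_iUnion.1 (hcov (Set.mem_univ (⟨x, hx⟩ : a)))
    exact ⟨j, ⟨x, hx⟩, hj, rfl⟩

end Hyperspace

end HyperspaceReflection

/-! ### Transfer between subcontinua of `X` and subcontinua of `wL` -/

namespace HyperspaceReflection

open Topology Wallman

/-- The basic closed set of an element, as a term of the lattice of closed sets. -/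
def hatClosed {N : Type*} [DistribLattice N] (a : N) : Closeds (Wallman N) := ⟨hat a, isClosed_hat a⟩

section Transfer

variable {X : Type u} [TopologicalSpace X] {L : Sublattice (Closeds X)}

/-- The set of subcontinua of `X` contained in `a` that meet all the sets `c j`, where `a` and the
`c j` are such that the subcontinuum `H` of `wL` is contained in the closed set given by `a` and
meets the closed sets given by the `c j`. Such sets of subcontinua approximate `H`. -/
def IsTest (H : Subcontinua (Wallman L)) (B : Set (Subcontinua X)) : Prop :=
  ∃ (a : L) (J : Type) (_ : Finite J) (c : J → L),
    (H.1 : Set (Wallman L)) ⊆ hat a ∧ (∀ j, ((H.1 : Set (Wallman L)) ∩ hat (c j)).Nonempty) ∧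
      B = {G | (G.1 : Set X) ⊆ (a : Closeds X) ∧
        ∀ j, ((G.1 : Set X) ∩ (c j : Closeds X)).Nonempty}

theorem IsTest.inter {H : Subcontinua (Wallman L)} {B C : Set (Subcontinua X)} (hB : IsTest H B)
    (hC : IsTest H C) : IsTest H (B ∩ C) := by
  obtain ⟨a, J, _, c, ha, hc, rfl⟩ := hB
  obtain ⟨a', J', _, c', ha', hc', rfl⟩ := hC
  refine ⟨a ⊓ a', J ⊕ J', inferInstance, Sum.elim c c', by simp [ha, ha'], ?_, ?_⟩
  · rintro (j | j)
    · exact hc j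
    · exact hc' j
  · ext G
    simp only [Set.mem_inter_iff, Set.mem_ofPred_eq, Sublattice.coe_inf, Closeds.coe_inf,
      Set.subset_inter_iff, Sum.forall, Sum.elim_inl, Sum.elim_inr]
    tauto

variable [BoundedOrder L]

theorem isTest_univ (htop : ((⊤ : L) : Closeds X) = ⊤) (H : Subcontinua (Wallman L)) :
    IsTest H (Set.univ : Set (Subcontinua X)) :=
  ⟨⊤, Fin 0, inferInstance, Fin.elim0, by simp, fun j => j.elim0, by
    ext G
    simp [htop]⟩

/-- A set of subcontinua of `X` and a set of subcontinua of `wL` correspond to each other if each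
subcontinuum `H` of `wL` has an approximation that is contained in the first set or disjoint from
it, according to whether `H` belongs to the second set. -/
def IsDual (A : Set (Subcontinua X)) (𝒜 : Set (Subcontinua (Wallman L))) : Prop :=
  IsClosed 𝒜 ∧ (∀ H ∈ 𝒜, ∃ B, IsTest H B ∧ B ⊆ A) ∧ ∀ H ∉ 𝒜, ∃ B, IsTest H B ∧ B ∩ A = ∅

theorem isDual_univ (htop : ((⊤ : L) : Closeds X) = ⊤) :
    IsDual (Set.univ : Set (Subcontinua X)) (Set.univ : Set (Subcontinua (Wallman L))) :=
  ⟨isClosed_univ, fun H _ => ⟨_, isTest_univ htop H, subset_rfl⟩, fun _ h => (h trivial).elim⟩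

theorem isDual_empty (htop : ((⊤ : L) : Closeds X) = ⊤) :
    IsDual (∅ : Set (Subcontinua X)) (∅ : Set (Subcontinua (Wallman L))) :=
  ⟨isClosed_empty, fun _ h => h.elim, fun H _ => ⟨_, isTest_univ htop H, by simp⟩⟩

omit [BoundedOrder L] in
theorem IsDual.union {A A' : Set (Subcontinua X)} {𝒜 𝒜' : Set (Subcontinua (Wallman L))}
    (h : IsDual A 𝒜) (h' : IsDual A' 𝒜') : IsDual (A ∪ A') (𝒜 ∪ 𝒜') := by
  refine ⟨h.1.union h'.1, ?_, ?_⟩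
  · rintro H (hH | hH)
    · obtain ⟨B, hB, hBA⟩ := h.2.1 H hH
      exact ⟨B, hB, hBA.trans Set.subset_union_left⟩
    · obtain ⟨B, hB, hBA⟩ := h'.2.1 H hH
      exact ⟨B, hB, hBA.trans Set.subset_union_right⟩
  · intro H hH
    rw [Set.mem_union, not_or] at hH
    obtain ⟨B, hB, hBA⟩ := h.2.2 H hH.1
    obtain ⟨B', hB', hBA'⟩ := h'.2.2 H hH.2
    refine ⟨B ∩ B', hB.inter hB', ?_⟩
    rw [Set.inter_union_distrib_left, Set.inter_right_comm, hBA, Set.inter_assoc, hBA']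
    simp

omit [BoundedOrder L] in
theorem IsDual.inter {A A' : Set (Subcontinua X)} {𝒜 𝒜' : Set (Subcontinua (Wallman L))}
    (h : IsDual A 𝒜) (h' : IsDual A' 𝒜') : IsDual (A ∩ A') (𝒜 ∩ 𝒜') := by
  refine ⟨h.1.inter h'.1, ?_, ?_⟩
  · rintro H ⟨hH, hH'⟩
    obtain ⟨B, hB, hBA⟩ := h.2.1 H hH
    obtain ⟨B', hB', hBA'⟩ := h'.2.1 H hH'
    exact ⟨B ∩ B', hB.inter hB', Set.inter_subset_inter hBA hBA'⟩
  · intro H hH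
    rw [Set.mem_inter_iff, not_and_or] at hH
    rcases hH with hH | hH
    · obtain ⟨B, hB, hBA⟩ := h.2.2 H hH
      exact ⟨B, hB, by rw [← Set.inter_assoc, hBA, Set.empty_inter]⟩
    · obtain ⟨B, hB, hBA⟩ := h'.2.2 H hH
      exact ⟨B, hB, by rw [Set.inter_left_comm, hBA, Set.inter_empty]⟩

theorem exists_finite_inf (htop : ((⊤ : L) : Closeds X) = ⊤) {J : Type} [Finite J] (F : J → L) :
    ∃ c : L, (∀ x, x ∈ ((c : Closeds X) : Set X) ↔ ∀ j, x ∈ ((F j : Closeds X) : Set X)) ∧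
      ∀ p, p ∈ hat c ↔ ∀ j, p ∈ hat (F j) := by
  classical
  have := Fintype.ofFinite J
  have key : ∀ s : Finset J, ∃ c : L,
      (∀ x, x ∈ ((c : Closeds X) : Set X) ↔ ∀ j ∈ s, x ∈ ((F j : Closeds X) : Set X)) ∧
      ∀ p, p ∈ hat c ↔ ∀ j ∈ s, p ∈ hat (F j) := by
    intro s
    induction s using Finset.induction_on with
    | empty => exact ⟨⊤, by simp [htop], by simp⟩
    | insert j s hj ih =>
      obtain ⟨c, h1, h2⟩ := ih
      refine ⟨F j ⊓ c, fun x => ?_, fun p => ?_⟩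
      · rw [Finset.forall_mem_insert, ← h1]
        exact Iff.rfl
      · rw [Finset.forall_mem_insert, ← h2, hat_inf]
        exact Iff.rfl
  simpa using key Finset.univ

theorem inf_eq_bot_iff_forall (hbot : ((⊥ : L) : Closeds X) = ⊥) {a b : L} :
    a ⊓ b = ⊥ ↔ ∀ x ∈ ((a : Closeds X) : Set X), x ∉ ((b : Closeds X) : Set X) := by
  rw [← Subtype.coe_inj, hbot, ← SetLike.coe_set_eq]
  change ((a : Closeds X) : Set X) ∩ ((b : Closeds X) : Set X) = ∅ ↔ _
  rw [Set.eq_empty_iff_forall_notMem]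
  simp

theorem isDual_starSet (hbot : ((⊥ : L) : Closeds X) = ⊥) (htop : ((⊤ : L) : Closeds X) = ⊤)
    (hn : IsNormalLattice L) (hd : IsDisjunctive L) {J : Type} [Finite J] (F : J → L) :
    IsDual (starSet (Set.range fun j => (F j : Closeds X)))
      (starSet (Set.range fun j => hatClosed (F j))) := by
  obtain ⟨c, hcX, hcL⟩ := exists_finite_inf htop F
  refine ⟨isClosed_starSet (Set.finite_range _), fun H hH => ?_, fun H hH => ?_⟩
  · rcases mem_starSet.1 hH with ⟨p, hpH, hp⟩ | ⟨_, ⟨j, rfl⟩, hj⟩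
    · refine ⟨_, ⟨⊤, Unit, inferInstance, fun _ => c, by simp,
        fun _ => ⟨p, hpH, (hcL p).2 fun j => hp _ ⟨j, rfl⟩⟩, rfl⟩, ?_⟩
      rintro G ⟨-, hG⟩
      obtain ⟨x, hxG, hxc⟩ := hG ()
      refine mem_starSet.2 (.inl ⟨x, hxG, ?_⟩)
      rintro _ ⟨j, rfl⟩
      exact (hcX x).1 hxc j
    · refine ⟨_, ⟨F j, Fin 0, inferInstance, Fin.elim0, hj, fun j => j.elim0, rfl⟩, ?_⟩
      rintro G ⟨hG, -⟩
      exact mem_starSet.2 (.inr ⟨_, ⟨j, rfl⟩, hG⟩)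
  · have := t2Space hn
    rw [mem_starSet, not_or] at hH
    push Not at hH
    have hdisj : Disjoint (H.1 : Set (Wallman L)) (hat c) := by
      refine Set.disjoint_left.2 fun p hpH hpc => ?_
      obtain ⟨_, ⟨j, rfl⟩, hj⟩ := hH.1 p hpH
      exact hj ((hcL p).1 hpc j)
    obtain ⟨a, b, hab, hHa, hcb⟩ :=
      exists_subset_hat hn H.1.isCompact.isClosed (isClosed_hat c) hdisj
    rw [hat_subset_hat hd] at hcb
    have hp : ∀ j, ∃ d : L, d ⊓ F j = ⊥ ∧ ((H.1 : Set (Wallman L)) ∩ hat d).Nonempty := by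
      intro j
      obtain ⟨p, hpH, hp⟩ := Set.not_subset.1 (hH.2 _ ⟨j, rfl⟩)
      obtain ⟨d, hdp, hdF⟩ := exists_disjoint_of_notMem hp
      exact ⟨d, hdF, p, hpH, hdp⟩
    choose d hdF hdH using hp
    refine ⟨_, ⟨a, J, inferInstance, d, hHa, hdH, rfl⟩, Set.eq_empty_of_forall_notMem ?_⟩
    rintro G ⟨⟨hGa, hGd⟩, hG⟩
    rcases mem_starSet.1 hG with ⟨x, hxG, hx⟩ | ⟨_, ⟨j, rfl⟩, hj⟩
    · exact (inf_eq_bot_iff_forall hbot).1 hab x (hGa hxG)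
        (hcb ((hcX x).2 fun j => hx _ ⟨j, rfl⟩))
    · obtain ⟨x, hxG, hxd⟩ := hGd j
      exact (inf_eq_bot_iff_forall hbot).1 (hdF j) x hxd (hj hxG)

variable [CompactSpace X] [T2Space X]

/-- The approximations of a subcontinuum of `wL` are nonempty: otherwise the closed set `a` of `X`
splits into finitely many clopen pieces each of which misses some `c j`; if `L` contains such a
splitting, it induces one of the basic closed set of `a` in `wL`, and the connected set `H` would
lie in one of its pieces. -/
theorem IsTest.nonempty (hbot : ((⊥ : L) : Closeds X) = ⊥)
    (hsplit : ∀ (J : Type) [Finite J] (a : L) (c : J → L) (P Q : J → Closeds X),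
      (∀ j, P j ⊔ Q j = a ∧ P j ⊓ Q j = ⊥ ∧ P j ⊓ (c j : Closeds X) = ⊥) →
      (∀ x ∈ ((a : Closeds X) : Set X), ∃ j, x ∈ (P j : Set X)) →
      ∃ P Q : J → L, (∀ j, P j ⊔ Q j = a ∧ P j ⊓ Q j = ⊥ ∧ P j ⊓ c j = ⊥) ∧
        ∀ x ∈ ((a : Closeds X) : Set X), ∃ j, x ∈ ((P j : Closeds X) : Set X))
    (htop : ((⊤ : L) : Closeds X) = ⊤)
    {H : Subcontinua (Wallman L)} {B : Set (Subcontinua X)} (hB : IsTest H B) : B.Nonempty := by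
  obtain ⟨a, J, _, c, ha, hc, rfl⟩ := hB
  by_contra hne
  obtain ⟨P₀, Q₀, h1, h2⟩ := exists_splitting (a := (a : Closeds X))
    (c := fun j => (c j : Closeds X)) (fun G hG => by
      by_contra! hGc
      exact hne ⟨G, hG, hGc⟩)
  obtain ⟨P, Q, hPQ, hcov⟩ := hsplit J a c P₀ Q₀ h1 h2
  have hHQ : ∀ j, (H.1 : Set (Wallman L)) ⊆ hat (Q j) := by
    intro j
    obtain ⟨hsup, hinf, hPc⟩ := hPQ j
    refine (isPreconnected_iff_subset_of_disjoint_closed.1 H.2.2 (hat (P j)) (hat (Q j))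
      (isClosed_hat _) (isClosed_hat _) (by rwa [← hat_sup, hsup]) ?_).resolve_left fun hHP => ?_
    · rw [inf_eq_bot_iff.1 hinf, Set.inter_empty]
    · obtain ⟨p, hpH, hpc⟩ := hc j
      exact Set.eq_empty_iff_forall_notMem.1 (inf_eq_bot_iff.1 hPc) p ⟨hHP hpH, hpc⟩
  obtain ⟨d, hdX, hdL⟩ := exists_finite_inf htop Q
  have hd : a ⊓ d = ⊥ := by
    refine (inf_eq_bot_iff_forall hbot).2 fun x hxa hxd => ?_
    obtain ⟨j, hj⟩ := hcov x hxa
    exact (inf_eq_bot_iff_forall hbot).1 (hPQ j).2.1 x hj ((hdX x).1 hxd j)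
  obtain ⟨p, hp⟩ := H.2.1
  exact Set.eq_empty_iff_forall_notMem.1 (inf_eq_bot_iff.1 hd) p
    ⟨ha hp, (hdL p).2 fun j => hHQ j hp⟩

omit [BoundedOrder L] [CompactSpace X] [T2Space X] in
theorem IsDual.unique (hne : ∀ (H : Subcontinua (Wallman L)) (B : Set (Subcontinua X)),
      IsTest H B → B.Nonempty)
    {A : Set (Subcontinua X)} {𝒜 𝒜' : Set (Subcontinua (Wallman L))}
    (h : IsDual A 𝒜) (h' : IsDual A 𝒜') : 𝒜 = 𝒜' := by
  have key : ∀ {𝒜 𝒜' : Set (Subcontinua (Wallman L))}, IsDual A 𝒜 → IsDual A 𝒜' → 𝒜 ⊆ 𝒜' := by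
    intro 𝒜 𝒜' h h' H hH
    by_contra hH'
    obtain ⟨B, hB, hBA⟩ := h.2.1 H hH
    obtain ⟨B', hB', hBA'⟩ := h'.2.2 H hH'
    obtain ⟨G, hGB, hGB'⟩ := hne H _ (hB.inter hB')
    exact Set.eq_empty_iff_forall_notMem.1 hBA' G ⟨hGB', hBA hGB⟩
  exact (key h h').antisymm (key h' h)

omit [CompactSpace X] [T2Space X] in
/-- If `A` contains a subcontinuum that belongs to `L`, then the set of subcontinua of `wL`
corresponding to `A` is nonempty. -/
theorem IsDual.nonempty (hbot : ((⊥ : L) : Closeds X) = ⊥) (hn : IsNormalLattice L)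
    (hd : IsDisjunctive L) {A : Set (Subcontinua X)} {𝒜 : Set (Subcontinua (Wallman L))}
    (h : IsDual A 𝒜) {G : Subcontinua X} (hG : G ∈ A) {g : L}
    (hg : ((g : Closeds X) : Set X) = G.1) : 𝒜.Nonempty := by
  have hg0 : g ≠ ⊥ := by
    rintro rfl
    obtain ⟨x, hx⟩ := G.2.1
    rw [← hg, hbot] at hx
    exact hx
  have hne : (hat g).Nonempty := exists_mem_hat hg0
  have hconn : IsPreconnected (hat g) := by
    refine isPreconnected_hat hn hd fun b c hbc hgbc => ?_
    have := isPreconnected_iff_subset_of_disjoint_closed.1 G.2.2 (b : Closeds X) (c : Closeds X)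
      (b : Closeds X).isClosed (c : Closeds X).isClosed (hg ▸ hgbc)
      (Set.eq_empty_of_forall_notMem fun x hx =>
        (inf_eq_bot_iff_forall hbot).1 hbc x hx.2.1 hx.2.2)
    rw [← hg] at this
    exact this
  let H : Subcontinua (Wallman L) := ⟨⟨⟨hat g, (isClosed_hat g).isCompact⟩, hne⟩, hne, hconn⟩
  refine ⟨H, by_contra fun hH => ?_⟩
  obtain ⟨_, ⟨a, J, _, c, ha, hc, rfl⟩, hB⟩ := h.2.2 H hH
  refine Set.eq_empty_iff_forall_notMem.1 hB G ⟨⟨?_, fun j => ?_⟩, hG⟩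
  · rw [← hg]
    exact (hat_subset_hat hd).1 ha
  · rw [← hg]
    by_contra hempty
    obtain ⟨p, hp⟩ := hc j
    refine Set.eq_empty_iff_forall_notMem.1 (inf_eq_bot_iff.1
      ((inf_eq_bot_iff_forall hbot).2 fun x hxg hxc => hempty ⟨x, hxg, hxc⟩)) p hp

end Transfer

end HyperspaceReflection

/-! ### The Wallman spaces of `K*`, `L` and `K` -/

namespace HyperspaceReflection

open Topology Wallman

theorem mem_elems {κ : Cardinal.{u}} {M : setLang.ElementarySubstructure (HSet κ)} {x : HSet κ} :
    x.1 ∈ elems M ↔ x ∈ M :=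
  Subtype.val_injective.mem_set_image

section KStar

variable {X : Type u} [TopologicalSpace X]

theorem starSet_mem_latticeKStar {𝓕 : Set (Closeds X)} (h : 𝓕.Finite) :
    starSet 𝓕 ∈ latticeKStar X :=
  Sublattice.mem_sInf.2 fun _ hS => hS (.inr ⟨𝓕, h, rfl⟩)

theorem empty_mem_latticeKStar : ∅ ∈ latticeKStar X :=
  Sublattice.mem_sInf.2 fun _ hS => hS (.inl (.inl rfl))

theorem univ_mem_latticeKStar : Set.univ ∈ latticeKStar X :=
  Sublattice.mem_sInf.2 fun _ hS => hS (.inl (.inr rfl))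

theorem isClosed_of_mem_latticeKStar {A : Set (Subcontinua X)} (hA : A ∈ latticeKStar X) :
    IsClosed A := by
  refine Sublattice.mem_sInf.1 hA
    ⟨{A | IsClosed A}, fun A hA B hB => IsClosed.union hA hB,
      fun A hA B hB => IsClosed.inter hA hB⟩ ?_
  rintro B ((rfl | rfl) | ⟨𝓕, h𝓕, rfl⟩)
  · exact isClosed_empty
  · exact isClosed_univ
  · exact isClosed_starSet h𝓕

theorem nonempty_homeomorph_latticeKStar [CompactSpace X] [T2Space X] :
    Nonempty (Wallman (latticeKStar X) ≃ₜ Subcontinua X) := by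
  let _ : BoundedOrder (latticeKStar X) :=
    { top := ⟨_, univ_mem_latticeKStar⟩
      le_top := fun A => Set.subset_univ A.1
      bot := ⟨_, empty_mem_latticeKStar⟩
      bot_le := fun A => Set.empty_subset A.1 }
  refine nonempty_homeomorph (fun A : latticeKStar X => (A : Set (Subcontinua X)))
    (fun A => isClosed_of_mem_latticeKStar A.2) (fun _ _ => rfl) (fun _ _ => rfl) rfl
    (fun A => ⟨fun h => Subtype.ext h, fun h => h ▸ rfl⟩) fun G H hGH => ?_
  obtain ⟨m, n, f, g, h1, h2, h3⟩ := exists_starSet_separation (b := fun F : Closeds X => F)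
    (i₀ := ⊥) rfl (fun y F hy => by
      obtain ⟨U, V, hU, hV, hyU, hFV, hUV⟩ := SeparatedNhds.of_isCompact_isCompact
        isCompact_singleton F.isClosed.isCompact (Set.disjoint_singleton_left.2 hy)
      refine ⟨⟨Uᶜ, hU.isClosed_compl⟩, ⟨Vᶜ, hV.isClosed_compl⟩, Closeds.ext ?_,
        fun h => h (hyU rfl), Closeds.ext ?_⟩
      · refine Set.eq_univ_of_forall fun x => ?_
        by_contra! hx
        exact Set.disjoint_left.1 hUV (not_not.1 fun h => hx (.inl h))
          (not_not.1 fun h => hx (.inr h))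
      · exact Set.eq_empty_of_forall_notMem fun x hx => hx.1 (hFV hx.2)) hGH
  exact ⟨⟨_, starSet_mem_latticeKStar (Set.finite_range _)⟩,
    ⟨_, starSet_mem_latticeKStar (Set.finite_range _)⟩, h1, h2, h3⟩

end KStar

end HyperspaceReflection

theorem mainTheorem3 (X : Type u) [TopologicalSpace X] [CompactSpace X] [T2Space X]
    [ConnectedSpace X]
    -- a realisation of the points of `X` as ZFC sets, which makes `X` a space in the universe `V`
    (e : X ↪ ZFSet.{u})
    -- a regular cardinal `κ` with `𝒫(𝒫(X)) ∈ H(κ)`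
    (κ : Cardinal.{u}) (hκ : κ.IsRegular)
    (hX : (code e Set.univ).powerset.powerset ∈ HSet κ)
    -- a countable elementary submodel `M ≺ H(κ)` with `X ∈ M`
    (M : setLang.ElementarySubstructure (HSet κ))
    (hMc : (M : Set (HSet κ)).Countable)
    (hXM : codeSpace X e ∈ elems M) :
    Nonempty (Wallman (latticeKStar X) ≃ₜ
      Subcontinua X) ∧
    -- `L = 2^X ∩ M` and `K = K* ∩ M` are lattices with the `0` and `1` of `2^X` and of `K*`
    ∃ (L : Sublattice (Closeds X))
      (K : Sublattice (Set (Subcontinua X))),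
      (∀ F : Closeds X, F ∈ L ↔
        code e (F : Set X) ∈ elems M) ∧
      (∀ A : Set (Subcontinua X), A ∈ K ↔
        A ∈ latticeKStar X ∧
        code (codeSubcontinuum e) A ∈
          elems M) ∧
      (⊥ ∈ L ∧ ⊤ ∈ L) ∧ (∅ ∈ K ∧ Set.univ ∈ K) ∧
      -- `wL` is a metric continuum
      (CompactSpace (Wallman L) ∧
        ConnectedSpace (Wallman L) ∧
        MetrizableSpace (Wallman L)) ∧
      -- `wK` is homeomorphic to `C(wL)`
      Nonempty (Wallman K ≃ₜ
        Subcontinua (Wallman L)) := by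
  refine ⟨nonempty_homeomorph_latticeKStar, ?_⟩
  obtain ⟨hP, hT⟩ := setH_univ_mem_and_topH_mem (hX := hX) hXM
  let L : Sublattice (Closeds X) :=
    ⟨{F | setH hX (F : Set X) ∈ M}, fun _ hF _ hG => setH_union_mem hP hF hG,
      fun _ hF _ hG => setH_inter_mem hP hF hG⟩
  let K : Sublattice (Set (Subcontinua X)) :=
    ⟨{A | A ∈ latticeKStar X ∧ famH hX A ∈ M},
      fun A hA B hB => ⟨(latticeKStar X).supClosed hA.1 hB.1, famH_union_mem hP hT hA.2 hB.2⟩,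
      fun A hA B hB => ⟨(latticeKStar X).infClosed hA.1 hB.1, famH_inter_mem hP hT hA.2 hB.2⟩⟩
  have hbotL : ⊥ ∈ L := setH_empty_mem hP
  have htopL : ⊤ ∈ L := hP
  have hbotK : ∅ ∈ K := ⟨empty_mem_latticeKStar, famH_empty_mem hP hT⟩
  have htopK : Set.univ ∈ K := ⟨univ_mem_latticeKStar, famH_univ_mem hP hT⟩
  let _ : BoundedOrder L :=
    { top := ⟨⊤, htopL⟩
      le_top := fun F => le_top (a := F.1)
      bot := ⟨⊥, hbotL⟩
      bot_le := fun F => bot_le (a := F.1) }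
  let _ : BoundedOrder K :=
    { top := ⟨_, htopK⟩
      le_top := fun A => Set.subset_univ A.1
      bot := ⟨_, hbotK⟩
      bot_le := fun A => Set.empty_subset A.1 }
  have hbot : ((⊥ : L) : Closeds X) = ⊥ := rfl
  have htop : ((⊤ : L) : Closeds X) = ⊤ := rfl
  have hn : IsNormalLattice L := by
    intro F G hFG
    obtain ⟨U, V, hU, hV, h1, h2, h3⟩ := exists_normal_mem hP hT F.2 G.2 (congrArg Subtype.val hFG)
    exact ⟨⟨U, hU⟩, ⟨V, hV⟩, Subtype.ext h1, Subtype.ext h2, Subtype.ext h3⟩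
  have hd : IsDisjunctive L := by
    intro F G hFG
    obtain ⟨U, hU, h1, h2, h3⟩ := exists_disjoint_le_mem hP hT F.2 G.2 hFG
    exact ⟨⟨U, hU⟩, fun h => h1 (congrArg Subtype.val h), h2, Subtype.ext h3⟩
  have hnt : ∀ (H : Subcontinua (Wallman L)) (B : Set (Subcontinua X)),
      IsTest H B → B.Nonempty := by
    refine fun H B hB => hB.nonempty hbot (fun J _ a c P Q hPQ hcov => ?_) htop
    obtain ⟨P', Q', hP', hQ', h1, h2⟩ :=
      exists_splitting_mem hP hT a.2 (fun j => (c j).2) hPQ hcov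
    exact ⟨fun j => ⟨P' j, hP' j⟩, fun j => ⟨Q' j, hQ' j⟩,
      fun j => ⟨Subtype.ext (h1 j).1, Subtype.ext (h1 j).2.1, Subtype.ext (h1 j).2.2⟩, h2⟩
  have := Wallman.t2Space hn
  have hcount : Countable L := by
    have : Countable M := hMc.to_subtype
    refine Function.Injective.countable (f := fun F : L => (⟨_, F.2⟩ : M)) fun F G h => ?_
    exact Subtype.ext (SetLike.coe_injective (setH_injective (hX := hX) (congrArg Subtype.val h)))
  have hconn : ConnectedSpace (Wallman L) := by
    have hpre : IsPreconnected (hat (⊤ : L)) := by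
      refine Wallman.isPreconnected_hat hn hd fun b c hbc h => ?_
      exact isPreconnected_iff_subset_of_disjoint_closed.1 isPreconnected_univ (b : Closeds X)
        (c : Closeds X) (b : Closeds X).isClosed (c : Closeds X).isClosed h
        (Set.eq_empty_of_forall_notMem fun x hx =>
          (inf_eq_bot_iff_forall hbot).1 hbc x hx.2.1 hx.2.2)
    rw [Wallman.hat_top] at hpre
    obtain ⟨p, -⟩ := Wallman.exists_mem_hat (a := (⊤ : L)) fun h => by
      obtain ⟨x⟩ := (inferInstance : Nonempty X)
      have : x ∈ (((⊤ : L) : Closeds X) : Set X) := trivial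
      rw [h] at this
      exact this
    exact { isPreconnected_univ := hpre, toNonempty := ⟨p⟩ }
  have hdual : ∀ A : K, ∃ 𝒜 : Set (Subcontinua (Wallman L)), IsDual A.1 𝒜 := fun A =>
    latticeKStar_induction hP hT (Φ := fun A => ∃ 𝒜 : Set (Subcontinua (Wallman L)), IsDual A 𝒜)
      ⟨_, isDual_empty htop⟩ ⟨_, isDual_univ htop⟩
      (fun _ _ ⟨_, h⟩ ⟨_, h'⟩ => ⟨_, h.union h'⟩) (fun _ _ ⟨_, h⟩ ⟨_, h'⟩ => ⟨_, h.inter h'⟩)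
      (fun J _ F hF => ⟨_, isDual_starSet hbot htop hn hd fun j => ⟨F j, hF j⟩⟩) A.2.1 A.2.2
  choose φ hφ using hdual
  have hstar : ∀ {n : ℕ} (f : Fin n → L), ∃ A : K,
      φ A = starSet (Set.range (hatClosed ∘ f)) := fun f =>
    ⟨⟨_, starSet_mem_latticeKStar (Set.finite_range _), famH_starSet_mem hP hT fun j => (f j).2⟩,
      (hφ _).unique hnt (isDual_starSet hbot htop hn hd f)⟩
  refine ⟨L, K, fun F => (mem_elems (x := setH hX (F : Set X))).symm,
    fun A => and_congr_right fun _ => (mem_elems (x := famH hX A)).symm, ⟨hbotL, htopL⟩,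
    ⟨hbotK, htopK⟩, ⟨inferInstance, hconn, Wallman.metrizableSpace hn⟩,
    Wallman.nonempty_homeomorph φ (fun A => (hφ A).1)
      (fun A B => (hφ _).unique hnt ((hφ A).inter (hφ B)))
      (fun A B => (hφ _).unique hnt ((hφ A).union (hφ B)))
      ((hφ _).unique hnt (isDual_univ htop)) (fun A => ⟨fun h => ?_, ?_⟩) fun G H hGH => ?_⟩
  · by_contra hA
    have hne : (A : Set (Subcontinua X)).Nonempty :=
      Set.nonempty_iff_ne_empty.2 fun h => hA (Subtype.ext h)
    obtain ⟨G, hG, hGM⟩ := exists_subcontinuum_mem hP hT A.2.2 hne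
    exact ((hφ A).nonempty hbot hn hd hG
      (g := ⟨⟨G.1, G.1.isCompact.isClosed⟩, hGM⟩) rfl).ne_empty h
  · rintro rfl
    exact (hφ _).unique hnt (isDual_empty htop)
  · obtain ⟨m, n, f, g, h1, h2, h3⟩ := exists_starSet_separation
      (b := fun F : L => hatClosed F) (i₀ := ⊥) (Closeds.ext Wallman.hat_bot) (fun p F hp => by
        obtain ⟨a, b, hab, ha, hb⟩ := Wallman.exists_subset_hat hn isClosed_singleton F.isClosed
          (Set.disjoint_singleton_left.2 hp)
        obtain ⟨u, v, huv, hu, hv⟩ := hn a b hab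
        refine ⟨u, v, Closeds.ext ?_, Wallman.notMem_of_inf_eq_bot hu (ha rfl), Closeds.ext ?_⟩
        · change hat u ∪ hat v = Set.univ
          rw [← Wallman.hat_sup, huv, Wallman.hat_top]
        · refine Set.eq_empty_of_forall_notMem fun q hq => ?_
          exact Wallman.notMem_of_inf_eq_bot hv (hb hq.2) hq.1) hGH
    obtain ⟨A, hA⟩ := hstar f
    obtain ⟨B, hB⟩ := hstar g
    exact ⟨A, B, by rw [hA, hB]; exact h1, by rw [hA]; exact h2, by rw [hB]; exact h3⟩
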